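/- For integers $s,t\ge 3$ and $p\ge 0$ let the Rose tree $\mathcal R(s,t,p)$ be the graph obtained from a path with vertices $1,\dots,s+t+1$ and a star with $p$ leaves by adding an edge between the vertex $s+1$ of the path and the center of the star. A Fiedler vector of a connected graph $G$ is an eigenvector of the Laplacian matrix $L(G)$ for its smallest nonzero eigenvalue. If the Fiedler vector $\Phi$ of $G$ is unique up to a multiplicative constant, $G$ is said to satisfy (FED) if $\Phi$ attains its minimum at exactly one vertex $m$ and its maximum at exactly one vertex $M$, and the distance from $m$ to $M$ is the diameter of $G$. Put $r(s)=2\bigl(1-\cos\frac{\pi}{2s+1}\bigr)$. Theorem. For all integers $s,t\ge 3$, $p\ge 0$, the Fiedler vector of $\mathcal R(s,t,p)$ is unique up to a multiplicative constant. There exist real-valued functions $f_m,f_M$ of pairs of integers $s,t\ge 3$ which are best-possible thresholds for (FED): for all $s,t\ge3$ and every integer $n\ge 0$, $$n\le f_m(s,t)\iff \mathcal R(s,t,p)\text{ satisfies (FED) for all integers }0\le p\le n,$$ $$n> f_M(s,t)\iff \mathcal R(s,t,p)\text{ does not satisfy (FED) for any integer }p\ge n$$ (in particular (FED) is true for $\mathcal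 R(s,t,p)$ if $p\le f_m(s,t)$ and false if $p>f_M(s,t)$), and such that moreover: 1. for every $s\ge 3$, $\displaystyle f_m(s,s)=f_M(s,s)=\frac{(r(s)-1)^2}{r(s)}$, and this value is asymptotically equivalent to $\frac{4}{\pi^2}s^2$ as $s\to+\infty$; 2. for every fixed $s\ge 3$, $\sup_{t\ge 3} f_M(s,t)<+\infty$; consequently, for every integer $p>\sup_{t\ge3}f_M(s,t)$, (FED) is false for $\mathcal R(s,t,p)$ for all $t\ge 3$. -/

import Mathlib

open Filter Asymptotics

/-- `Φ` is a Fiedler vector of the finite (connected) graph `G`: an eigenvector of the Laplacian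
matrix `L(G) = D - A` for the smallest nonzero eigenvalue of `L(G)`. -/
def IsFiedlerVector {V : Type*} [Fintype V] [DecidableEq V] (G : SimpleGraph V)
    [DecidableRel G.Adj] (Φ : V → ℝ) : Prop :=
  ∃ α : ℝ,
    IsLeast {μ : ℝ | μ ≠ 0 ∧ Module.End.HasEigenvalue (Matrix.toLin' (G.lapMatrix ℝ)) μ} α ∧
    Module.End.HasEigenvector (Matrix.toLin' (G.lapMatrix ℝ)) α Φ

/-- `G` has a Fiedler vector, and it is unique up to a multiplicative constant. -/
def HasUniqueFiedlerVector {V : Type*} [Fintype V] [DecidableEq V] (G : SimpleGraph V)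
    [DecidableRel G.Adj] : Prop :=
  (∃ Φ : V → ℝ, IsFiedlerVector G Φ) ∧
  ∀ Φ Ψ : V → ℝ, IsFiedlerVector G Φ → IsFiedlerVector G Ψ → ∃ a : ℝ, Ψ = a • Φ

/-- Property (FED), "Fiedler extrema diameter": the Fiedler vector of `G` is unique up to a
multiplicative constant, it attains its minimum at exactly one vertex `m` and its maximum at
exactly one vertex `M`, and the distance between `m` and `M` is the diameter of `G`. -/
def FED {V : Type*} [Fintype V] [DecidableEq V] (G : SimpleGraph V)
    [DecidableRel G.Adj] : Prop :=
  HasUniqueFiedlerVector G ∧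
  ∀ Φ : V → ℝ, IsFiedlerVector G Φ →
    ∃ m M : V, (∀ i, i ≠ m → Φ m < Φ i) ∧ (∀ i, i ≠ M → Φ i < Φ M) ∧ G.dist m M = G.diam

/-- The Rose tree `R(s,t,p)`: a path with the `s + t + 1` vertices `0, …, s + t` and a star with
center `inr (inl ())` and `p` leaves, together with an edge joining the vertex `s` of the path
(its `(s+1)`-st vertex) to the center of the star. -/
def roseTree (s t p : ℕ) : SimpleGraph (Fin (s + t + 1) ⊕ (Unit ⊕ Fin p)) :=
  (SimpleGraph.pathGraph (s + t + 1) ⊕g completeBipartiteGraph Unit (Fin p)) ⊔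
    SimpleGraph.edge (Sum.inl ⟨s, by omega⟩) (Sum.inr (Sum.inl ()))

noncomputable instance (s t p : ℕ) : DecidableRel (roseTree s t p).Adj := Classical.decRel _

/-- `r(s) = 2 (1 - cos (π / (2 s + 1)))`. -/
noncomputable def roseRadius (s : ℕ) : ℝ := 2 * (1 - Real.cos (Real.pi / (2 * (s : ℝ) + 1)))

/-!
Write `q(x) = 1 - (p + 2) x + x²`, and let `P₀(x) = 1, P₁(x) = 1 - x, …` (`pathSol`) be the solution
of the eigenvector equation along a path starting at an end. Removing the branch vertex `s` leaves
two path arms and a star. An eigenvector for `0 < α < 1` equals `a P_k(α)` on the left arm and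
`b P_k(α)` on the right arm, counted from the ends, has the value `c` at the center and `c / (1 - α)`
at the leaves, and its value at `s` is `a P_s(α) = b P_t(α) = c q(α) / (1 - α)`. So everything
depends on the signs of `P_s(α)`, `P_t(α)` and `q(α)`. These are controlled by the variational
principle: whenever two of the three branches carry a test vector with Rayleigh quotient at most
`x`, the algebraic connectivity is at most `x`
(`IsAlgebraicConnectivity.le_and_lt_of_separated`). Such a vector exists on an arm as soon as `P_k(x)`
becomes nonpositive along it, and on the star, with strict inequality, if `q(x) < 0`.

*Uniqueness.* The `α`-eigenspace is a line unless `P_s(α) = P_t(α) = q(α) = 0`. The two arms give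
`α ≤ r(min s t)`, while `r(s)` is the first zero of `P_s`, so in the exceptional case
`α = r(min s t)`. But `q` does not vanish there, since `exp (i π / (2 s + 1))` has degree
`φ(4 s + 2) ≥ 6` over `ℚ` (`roseQuad_roseRadius_ne_zero`).

*The case `s = t`.* If `q(r(s)) > 0`, then `α = r(s)` and the Fiedler vector is antisymmetric, with
its extrema at the ends. If `q(r(s)) < 0`, then `α < r(s)`, so `P_s(α) > 0` and `a = b`, and (FED)
fails. The condition `q(r) ≥ 0` reads `p ≤ (r - 1)² / r`.

*Large `p`.* Let `2 p ≥ s (s + 1)` and suppose (FED) holds, with `a > 0 > b`. The linear bound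
`P_s(α) ≥ 1 - s (s + 1) α / 2` and the test vectors on the left arm and the star give `P_s(α) > 0`.
Then the value at `s` is positive, so `P_t(α) < 0`, and the test vectors on the right arm and the
star give `q(α) ≥ 0`. As `q(α) < P_s(α)`, the leaves carry a value larger than `a`
(`roseTree_not_FED_of_le`). The bound on `p` does not involve `t`, which makes the upper threshold
bounded for fixed `s`.
-/

/-! ### The variational principle for the algebraic connectivity -/

open Matrix in
/-- Half of the min-max principle: a nonzero vector orthogonal to the constants, which span the
kernel of the Laplacian of a connected graph, bounds the smallest nonzero eigenvalue by its
Rayleigh quotient. -/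
theorem SimpleGraph.Connected.exists_hasEigenvalue_le {V : Type*} [Fintype V] [DecidableEq V]
    {G : SimpleGraph V} [DecidableRel G.Adj] (hG : G.Connected) {w : V → ℝ} {ρ : ℝ}
    (hw : w ≠ 0) (hsum : ∑ v, w v = 0)
    (hle : w ⬝ᵥ (G.lapMatrix ℝ *ᵥ w) ≤ ρ * (w ⬝ᵥ w)) :
    ∃ μ : ℝ, μ ≠ 0 ∧ Module.End.HasEigenvalue (Matrix.toLin' (G.lapMatrix ℝ)) μ ∧ μ ≤ ρ := by
  set A := G.lapMatrix ℝ with hA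
  have hH : A.IsHermitian := G.isHermitian_lapMatrix ℝ
  let e : V → V → ℝ := fun i => (hH.eigenvectorBasis i).ofLp
  have he : ∀ i, A *ᵥ e i = hH.eigenvalues i • e i := fun i => hH.mulVec_eigenvectorBasis i
  have he0 : ∀ i, e i ≠ 0 := fun i h => by
    have := hH.eigenvectorBasis.orthonormal.ne_zero i
    exact this (by ext v; exact congrFun h v)
  have hexp : w = ∑ i, (e i ⬝ᵥ w) • e i := by
    have := hH.eigenvectorBasis.sum_repr' (WithLp.toLp 2 w)
    funext v
    have h2 := congrArg (fun z => z.ofLp v) this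
    simp only [WithLp.ofLp_sum, WithLp.ofLp_smul, Finset.sum_apply, Pi.smul_apply] at h2
    rw [Finset.sum_apply, ← h2]
    refine Finset.sum_congr rfl fun i _ => ?_
    simp [e, EuclideanSpace.inner_eq_star_dotProduct, dotProduct_comm]
  have hww : w ⬝ᵥ w = ∑ i, (e i ⬝ᵥ w) ^ 2 := by
    conv_lhs => enter [1]; rw [hexp]
    simp [sum_dotProduct, sq]
  have hwA : w ⬝ᵥ (A *ᵥ w) = ∑ i, hH.eigenvalues i * (e i ⬝ᵥ w) ^ 2 := by
    conv_lhs => enter [1]; rw [hexp]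
    rw [sum_dotProduct]
    refine Finset.sum_congr rfl fun i _ => ?_
    have : e i ⬝ᵥ (A *ᵥ w) = hH.eigenvalues i * (e i ⬝ᵥ w) := by
      rw [dotProduct_mulVec, ← mulVec_transpose, (G.isSymm_lapMatrix (R := ℝ)).eq, he]
      simp
    rw [smul_dotProduct, this, smul_eq_mul]; ring
  by_contra! hcon
  -- Components along the kernel vanish because `w` is orthogonal to the constants.
  have hcomp : ∀ i, e i ⬝ᵥ w = 0 ∨ ρ < hH.eigenvalues i := by
    intro i
    by_cases h0 : hH.eigenvalues i = 0
    · left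
      have hk : A *ᵥ e i = 0 := by rw [he, h0, zero_smul]
      have hconst := (G.lapMatrix_mulVec_eq_zero_iff_forall_reachable).1 hk
      have : e i = fun _ => e i i := funext fun v => hconst v i (hG.preconnected v i)
      rw [this, dotProduct, ← Finset.mul_sum, hsum, mul_zero]
    · right
      refine hcon _ h0 (Module.End.hasEigenvalue_of_hasEigenvector (x := e i) ⟨?_, he0 i⟩)
      rw [Module.End.mem_eigenspace_iff, Matrix.toLin'_apply, he]
  have hz : ∀ i, (hH.eigenvalues i - ρ) * (e i ⬝ᵥ w) ^ 2 = 0 := by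
    have hnn : ∀ i ∈ Finset.univ, 0 ≤ (hH.eigenvalues i - ρ) * (e i ⬝ᵥ w) ^ 2 := by
      intro i _
      rcases hcomp i with h | h
      · simp [h]
      · exact mul_nonneg (sub_nonneg.2 h.le) (sq_nonneg _)
    have hs : ∑ i, (hH.eigenvalues i - ρ) * (e i ⬝ᵥ w) ^ 2 = 0 := by
      refine le_antisymm ?_ (Finset.sum_nonneg hnn)
      simp only [sub_mul, Finset.sum_sub_distrib, ← Finset.mul_sum]
      rw [← hwA, ← hww]; linarith
    intro i
    exact (Finset.sum_eq_zero_iff_of_nonneg hnn).1 hs i (Finset.mem_univ i)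
  apply hw
  rw [hexp]
  refine Finset.sum_eq_zero fun i _ => ?_
  rcases hcomp i with h | h
  · rw [h, zero_smul]
  · rcases mul_eq_zero.1 (hz i) with h' | h'
    · exact absurd h (by linarith)
    · rw [pow_eq_zero_iff two_ne_zero] at h'; rw [h', zero_smul]

theorem SimpleGraph.Connected.exists_isFiedlerVector {V : Type*} [Fintype V] [DecidableEq V]
    [Nontrivial V] {G : SimpleGraph V} [DecidableRel G.Adj] (hG : G.Connected) :
    ∃ Φ, IsFiedlerVector G Φ := by
  obtain ⟨x, y, hxy⟩ := exists_pair_ne V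
  let w : V → ℝ := Pi.single x 1 - Pi.single y 1
  have hw : w ≠ 0 := fun h => by simpa [w, hxy] using congrFun h x
  have hsum : ∑ v, w v = 0 := by simp [w]
  have hww : 0 < dotProduct w w := by
    refine lt_of_le_of_ne (Finset.sum_nonneg fun i _ => mul_self_nonneg _) (Ne.symm ?_)
    simpa using hw
  obtain ⟨μ, hμ⟩ := hG.exists_hasEigenvalue_le hw hsum
    (ρ := dotProduct w ((G.lapMatrix ℝ).mulVec w) / dotProduct w w)
    (by rw [div_mul_cancel₀ _ hww.ne'])
  have hfin : {μ : ℝ | μ ≠ 0 ∧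
      Module.End.HasEigenvalue (Matrix.toLin' (G.lapMatrix ℝ)) μ}.Finite :=
    (Module.End.finite_hasEigenvalue (Matrix.toLin' (G.lapMatrix ℝ))).subset fun _ h => h.2
  obtain ⟨α, hα, hmin⟩ := Set.exists_min_image _ id hfin ⟨μ, hμ.1, hμ.2.1⟩
  obtain ⟨Φ, hΦ⟩ := hα.2.exists_hasEigenvector
  exact ⟨Φ, α, ⟨hα, fun b hb => hmin b hb⟩, hΦ⟩

/-- `α` is the algebraic connectivity of `G`: the smallest nonzero Laplacian eigenvalue. -/
def IsAlgebraicConnectivity {V : Type*} [Fintype V] [DecidableEq V] (G : SimpleGraph V)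
    [DecidableRel G.Adj] (α : ℝ) : Prop :=
  IsLeast {μ : ℝ | μ ≠ 0 ∧ Module.End.HasEigenvalue (Matrix.toLin' (G.lapMatrix ℝ)) μ} α

namespace IsAlgebraicConnectivity

open Matrix

variable {V : Type*} [Fintype V] [DecidableEq V] {G : SimpleGraph V} [DecidableRel G.Adj]
  {α : ℝ}

theorem pos (h : IsAlgebraicConnectivity G α) : 0 < α := by
  obtain ⟨Φ, hΦ⟩ := h.1.2.exists_hasEigenvector
  have h1 : G.lapMatrix ℝ *ᵥ Φ = α • Φ := by
    have := hΦ.apply_eq_smul; rwa [Matrix.toLin'_apply] at this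
  have h2 := (SimpleGraph.posSemidef_lapMatrix ℝ G).dotProduct_mulVec_nonneg Φ
  have hne := hΦ.2
  have h3 : 0 < Φ ⬝ᵥ Φ := by
    refine lt_of_le_of_ne (Finset.sum_nonneg fun i _ => mul_self_nonneg _) (Ne.symm ?_)
    simpa using hne
  rw [h1, star_trivial, dotProduct_smul, smul_eq_mul] at h2
  exact lt_of_le_of_ne (nonneg_of_mul_nonneg_left h2 h3) h.1.1.symm

theorem sum_eq_zero (h : IsAlgebraicConnectivity G α) {Φ : V → ℝ}
    (hΦ : G.lapMatrix ℝ *ᵥ Φ = α • Φ) : ∑ v, Φ v = 0 := by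
  have h1 : (fun _ : V => (1 : ℝ)) ⬝ᵥ (G.lapMatrix ℝ *ᵥ Φ) = 0 := by
    rw [dotProduct_mulVec, ← mulVec_transpose, (G.isSymm_lapMatrix (R := ℝ)).eq,
      G.lapMatrix_mulVec_const_eq_zero, zero_dotProduct]
  rw [hΦ, dotProduct_smul, smul_eq_mul] at h1
  simpa [dotProduct, h.1.1] using h1

/-- Test vectors `f`, `g` with disjoint supports joined by no edge span a plane on which the
Laplacian form is diagonal, and this plane contains a vector orthogonal to the constants. Hence
the algebraic connectivity is at most the larger of the two Rayleigh quotients; it is strictly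
below a common bound of them as soon as one of them is. -/
theorem le_and_lt_of_separated (h : IsAlgebraicConnectivity G α) (hG : G.Connected) {lam : ℝ}
    {f g : V → ℝ} (hf : 0 < ∑ v, f v) (hg : 0 < ∑ v, g v)
    (hfg : ∀ v, f v = 0 ∨ g v = 0)
    (hfL : ∀ v, g v = 0 ∨ (G.lapMatrix ℝ *ᵥ f) v = 0)
    (hf' : f ⬝ᵥ (G.lapMatrix ℝ *ᵥ f) ≤ lam * (f ⬝ᵥ f))
    (hg' : g ⬝ᵥ (G.lapMatrix ℝ *ᵥ g) ≤ lam * (g ⬝ᵥ g)) :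
    α ≤ lam ∧ (g ⬝ᵥ (G.lapMatrix ℝ *ᵥ g) < lam * (g ⬝ᵥ g) → α < lam) := by
  set L := G.lapMatrix ℝ with hL
  -- The test vector is `(∑ g) f - (∑ f) g`.
  set a := ∑ v, f v with ha
  set b := ∑ v, g v with hb
  have d1 : g ⬝ᵥ (L *ᵥ f) = 0 := Finset.sum_eq_zero fun v _ => by
    rcases hfL v with h | h <;> simp [h]
  have d2 : f ⬝ᵥ (L *ᵥ g) = 0 := by
    rw [dotProduct_mulVec, ← mulVec_transpose, (G.isSymm_lapMatrix (R := ℝ)).eq,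
      dotProduct_comm, d1]
  have d3 : f ⬝ᵥ g = 0 := Finset.sum_eq_zero fun v _ => by
    rcases hfg v with h | h <;> simp [h]
  have d4 : g ⬝ᵥ f = 0 := by rw [dotProduct_comm, d3]
  set w := b • f - a • g with hw
  have hsum : ∑ v, w v = 0 := by
    simp only [hw, Pi.sub_apply, Pi.smul_apply, smul_eq_mul, Finset.sum_sub_distrib,
      ← Finset.mul_sum]
    rw [← ha, ← hb]; ring
  have e1 : w ⬝ᵥ (L *ᵥ w) = b ^ 2 * (f ⬝ᵥ (L *ᵥ f)) + a ^ 2 * (g ⬝ᵥ (L *ᵥ g)) := by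
    simp only [hw, mulVec_sub, mulVec_smul, sub_dotProduct, dotProduct_sub, smul_dotProduct,
      dotProduct_smul, smul_eq_mul, d1, d2]
    ring
  have e2 : w ⬝ᵥ w = b ^ 2 * (f ⬝ᵥ f) + a ^ 2 * (g ⬝ᵥ g) := by
    simp only [hw, sub_dotProduct, dotProduct_sub, smul_dotProduct,
      dotProduct_smul, smul_eq_mul, d3, d4]
    ring
  have hwne : w ≠ 0 := by
    intro h0
    have hpos : 0 < f ⬝ᵥ f := by
      refine lt_of_le_of_ne (Finset.sum_nonneg fun i _ => mul_self_nonneg _) (Ne.symm ?_)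
      intro h1
      rw [dotProduct_self_eq_zero] at h1
      simp [ha, h1] at hf
    have hnn : 0 ≤ g ⬝ᵥ g := Finset.sum_nonneg fun i _ => mul_self_nonneg _
    rw [h0, zero_dotProduct] at e2
    have : 0 < b ^ 2 * (f ⬝ᵥ f) := by positivity
    have : 0 ≤ a ^ 2 * (g ⬝ᵥ g) := by positivity
    linarith
  have hwpos : 0 < w ⬝ᵥ w := by
    refine lt_of_le_of_ne (Finset.sum_nonneg fun i _ => mul_self_nonneg _) (Ne.symm ?_)
    simpa using hwne
  obtain ⟨μ, h0, hμ, hle⟩ := hG.exists_hasEigenvalue_le hwne hsum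
    (ρ := w ⬝ᵥ (L *ᵥ w) / w ⬝ᵥ w) (by rw [div_mul_cancel₀ _ hwpos.ne'])
  have hαμ : α ≤ w ⬝ᵥ (L *ᵥ w) / w ⬝ᵥ w := (h.2 ⟨h0, hμ⟩).trans hle
  have ha2 : 0 < a ^ 2 := by positivity
  have hb2 : 0 < b ^ 2 := by positivity
  have i1 := mul_le_mul_of_nonneg_left hf' hb2.le
  constructor
  · refine hαμ.trans ?_
    rw [div_le_iff₀ hwpos, e1, e2]
    have i2 := mul_le_mul_of_nonneg_left hg' ha2.le
    linarith
  · intro hlt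
    refine hαμ.trans_lt ?_
    rw [div_lt_iff₀ hwpos, e1, e2]
    have i2 := mul_lt_mul_of_pos_left hlt ha2
    linarith

end IsAlgebraicConnectivity

theorem isFiedlerVector_iff {V : Type*} [Fintype V] [DecidableEq V] {G : SimpleGraph V}
    [DecidableRel G.Adj] {Φ : V → ℝ} :
    IsFiedlerVector G Φ ↔
      ∃ α, IsAlgebraicConnectivity G α ∧ (G.lapMatrix ℝ).mulVec Φ = α • Φ ∧ Φ ≠ 0 := by
  simp only [IsFiedlerVector, IsAlgebraicConnectivity, Module.End.hasEigenvector_iff,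
    Module.End.mem_eigenspace_iff, Matrix.toLin'_apply]

/-! ### Paths and distances in the Rose tree -/

section RoseTree

variable {s t p : ℕ}

@[simp]
theorem roseTree_adj_inl_inl (i j : Fin (s + t + 1)) :
    (roseTree s t p).Adj (Sum.inl i) (Sum.inl j) ↔ i.val + 1 = j.val ∨ j.val + 1 = i.val := by
  simp [roseTree, SimpleGraph.edge_adj, SimpleGraph.pathGraph_adj]

@[simp]
theorem roseTree_adj_inl_center (i : Fin (s + t + 1)) (u : Unit) :
    (roseTree s t p).Adj (Sum.inl i) (Sum.inr (Sum.inl u)) ↔ i.val = s := by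
  simp [roseTree, SimpleGraph.edge_adj, Fin.ext_iff]

@[simp]
theorem roseTree_adj_center_inl (i : Fin (s + t + 1)) (u : Unit) :
    (roseTree s t p).Adj (Sum.inr (Sum.inl u)) (Sum.inl i) ↔ i.val = s := by
  rw [SimpleGraph.adj_comm, roseTree_adj_inl_center]

@[simp]
theorem not_roseTree_adj_inl_leaf (i : Fin (s + t + 1)) (j : Fin p) :
    ¬ (roseTree s t p).Adj (Sum.inl i) (Sum.inr (Sum.inr j)) := by
  simp [roseTree, SimpleGraph.edge_adj]

@[simp]
theorem not_roseTree_adj_leaf_inl (i : Fin (s + t + 1)) (j : Fin p) :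
    ¬ (roseTree s t p).Adj (Sum.inr (Sum.inr j)) (Sum.inl i) := by
  simp [roseTree, SimpleGraph.edge_adj]

@[simp]
theorem roseTree_adj_center_leaf (j : Fin p) (u : Unit) :
    (roseTree s t p).Adj (Sum.inr (Sum.inl u)) (Sum.inr (Sum.inr j)) := by
  simp [roseTree, SimpleGraph.edge_adj, completeBipartiteGraph]

@[simp]
theorem roseTree_adj_leaf_center (j : Fin p) (u : Unit) :
    (roseTree s t p).Adj (Sum.inr (Sum.inr j)) (Sum.inr (Sum.inl u)) :=
  (roseTree_adj_center_leaf j u).symm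

@[simp]
theorem not_roseTree_adj_leaf_leaf (i j : Fin p) :
    ¬ (roseTree s t p).Adj (Sum.inr (Sum.inr i)) (Sum.inr (Sum.inr j)) := by
  simp [roseTree, SimpleGraph.edge_adj, completeBipartiteGraph]

theorem roseTree_exists_walk_path (d : ℕ) :
    ∀ i j : Fin (s + t + 1), i.val + d = j.val →
      ∃ w : (roseTree s t p).Walk (Sum.inl i) (Sum.inl j), w.length = d := by
  induction d with
  | zero =>
    intro i j h
    obtain rfl : i = j := Fin.ext (by simpa using h)
    exact ⟨.nil, rfl⟩
  | succ d ih =>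
    intro i j h
    obtain ⟨w, hw⟩ := ih ⟨i + 1, by omega⟩ j (by simp; omega)
    exact ⟨.cons ((roseTree_adj_inl_inl _ _).2 (Or.inl rfl)) w, by simp [hw]⟩

theorem roseTree_dist_path_le (i j : Fin (s + t + 1)) (h : i ≤ j) :
    (roseTree s t p).dist (Sum.inl i) (Sum.inl j) ≤ j.val - i.val := by
  obtain ⟨w, hw⟩ := roseTree_exists_walk_path (p := p) (j.val - i.val) i j
    (by have : i.val ≤ j.val := h; omega)
  exact hw ▸ SimpleGraph.dist_le w

theorem roseTree_exists_walk_center (v : Unit ⊕ Fin p) :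
    ∃ w : (roseTree s t p).Walk (Sum.inr v) (Sum.inl ⟨s, by omega⟩), w.length ≤ 2 := by
  rcases v with ⟨⟩ | j
  · exact ⟨.cons (by simp) .nil, by simp⟩
  · exact ⟨.cons (roseTree_adj_leaf_center j ()) (.cons (by simp) .nil), by simp⟩

theorem roseTree_connected (s t p : ℕ) : (roseTree s t p).Connected := by
  rw [SimpleGraph.connected_iff_exists_forall_reachable]
  refine ⟨Sum.inl ⟨s, by omega⟩, ?_⟩
  rintro (i | v)
  · rcases le_total s i.val with h | h
    · obtain ⟨w, -⟩ := roseTree_exists_walk_path (p := p) (i.val - s) ⟨s, by omega⟩ i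
        (Nat.add_sub_cancel' h)
      exact w.reachable
    · obtain ⟨w, -⟩ := roseTree_exists_walk_path (p := p) (s - i.val) i ⟨s, by omega⟩
        (Nat.add_sub_cancel' h)
      exact w.reachable.symm
  · obtain ⟨w, -⟩ := roseTree_exists_walk_center (s := s) (t := t) v
    exact w.reachable.symm

theorem roseTree_dist_ends :
    (roseTree s t p).dist (Sum.inl ⟨0, by omega⟩) (Sum.inl ⟨s + t, by omega⟩) = s + t := by
  refine le_antisymm (roseTree_dist_path_le _ _ (Nat.zero_le _)) ?_
  -- The projection of the tree onto the path (the star goes to the vertex `s`) is `1`-Lipschitz.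
  let h : Fin (s + t + 1) ⊕ (Unit ⊕ Fin p) → ℕ := Sum.elim (fun i => i.val) (fun _ => s)
  have hadj : ∀ u v, (roseTree s t p).Adj u v → h v ≤ h u + 1 := by
    rintro (i | ⟨⟨⟩ | i⟩) (j | ⟨⟨⟩ | j⟩) huv <;> simp [h] at huv ⊢ <;> omega
  have hwalk : ∀ u v, ∀ w : (roseTree s t p).Walk u v, h v ≤ h u + w.length := by
    intro u v w
    induction w with
    | nil => simp
    | cons huv _ ih => have := hadj _ _ huv; rw [SimpleGraph.Walk.length_cons]; omega
  obtain ⟨w, hw⟩ := (roseTree_connected s t p).exists_walk_length_eq_dist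
    (Sum.inl ⟨0, by omega⟩) (Sum.inl ⟨s + t, by omega⟩)
  have := hwalk _ _ w
  simp only [h, Sum.elim_inl] at this
  omega

theorem roseTree_dist_le_and_eq (hs : 3 ≤ s) (ht : 3 ≤ t)
    (u v : Fin (s + t + 1) ⊕ (Unit ⊕ Fin p)) :
    (roseTree s t p).dist u v ≤ s + t ∧ ((roseTree s t p).dist u v = s + t →
      (u = Sum.inl ⟨0, by omega⟩ ∧ v = Sum.inl ⟨s + t, by omega⟩) ∨
      (v = Sum.inl ⟨0, by omega⟩ ∧ u = Sum.inl ⟨s + t, by omega⟩)) := by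
  have hc := roseTree_connected s t p
  have hstar : ∀ x : Unit ⊕ Fin p,
      (roseTree s t p).dist (Sum.inr x) (Sum.inl ⟨s, by omega⟩) ≤ 2 := fun x => by
    obtain ⟨w, hw⟩ := roseTree_exists_walk_center (s := s) (t := t) x
    exact (SimpleGraph.dist_le w).trans hw
  have hmix : ∀ (i : Fin (s + t + 1)) (x : Unit ⊕ Fin p),
      (roseTree s t p).dist (Sum.inr x) (Sum.inl i) < s + t := fun i x => by
    have h1 := hc.dist_triangle (u := Sum.inr x) (v := Sum.inl ⟨s, by omega⟩) (w := Sum.inl i)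
    have h2 := hstar x
    rcases le_total (⟨s, by omega⟩ : Fin (s + t + 1)) i with h | h
    · have h3 := roseTree_dist_path_le (p := p) _ _ h
      simp only at h3
      omega
    · have h3 := roseTree_dist_path_le (p := p) _ _ h
      rw [SimpleGraph.dist_comm] at h3
      simp only at h3
      omega
  rcases u with i | x <;> rcases v with j | y
  · rcases le_total i j with h | h
    · have h3 := roseTree_dist_path_le (p := p) _ _ h
      refine ⟨by omega, fun he => Or.inl ⟨?_, ?_⟩⟩ <;>
        simp only [Sum.inl.injEq, Fin.ext_iff] <;> omega
    · have h3 := roseTree_dist_path_le (p := p) _ _ h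
      rw [SimpleGraph.dist_comm] at h3
      refine ⟨by omega, fun he => Or.inr ⟨?_, ?_⟩⟩ <;>
        simp only [Sum.inl.injEq, Fin.ext_iff] <;> omega
  · have := hmix i y
    rw [SimpleGraph.dist_comm] at this
    exact ⟨this.le, fun he => absurd he this.ne⟩
  · have := hmix j x
    exact ⟨this.le, fun he => absurd he this.ne⟩
  · have h1 := hc.dist_triangle (u := Sum.inr x) (v := Sum.inl ⟨s, by omega⟩) (w := Sum.inr y)
    have h2 := hstar x
    have h3 := hstar y
    rw [SimpleGraph.dist_comm] at h3
    have : (roseTree s t p).dist (Sum.inr x) (Sum.inr y) < s + t := by omega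
    exact ⟨this.le, fun he => absurd he this.ne⟩

theorem roseTree_diam (hs : 3 ≤ s) (ht : 3 ≤ t) : (roseTree s t p).diam = s + t := by
  refine le_antisymm ?_ ?_
  · obtain ⟨u, v, h⟩ := (roseTree s t p).exists_dist_eq_diam
    exact h ▸ (roseTree_dist_le_and_eq hs ht u v).1
  · exact roseTree_dist_ends.symm.le.trans (SimpleGraph.dist_le_diam
      (SimpleGraph.connected_iff_ediam_ne_top.1 (roseTree_connected s t p)))

/-! ### The Laplacian of the Rose tree -/

/-- The vector on the Rose tree with values `F 0, …, F (s + t)` on the path, `c` at the center of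
the star and `Y j` at its leaves. -/
def roseVec (s t p : ℕ) (F : ℕ → ℝ) (c : ℝ) (Y : Fin p → ℝ) :
    Fin (s + t + 1) ⊕ (Unit ⊕ Fin p) → ℝ :=
  Sum.elim (fun i => F i) (Sum.elim (fun _ => c) Y)

@[simp] theorem roseVec_inl (F : ℕ → ℝ) (c : ℝ) (Y : Fin p → ℝ) (i : Fin (s + t + 1)) :
    roseVec s t p F c Y (Sum.inl i) = F i := rfl

@[simp] theorem roseVec_center (F : ℕ → ℝ) (c : ℝ) (Y : Fin p → ℝ) (u : Unit) :
    roseVec s t p F c Y (Sum.inr (Sum.inl u)) = c := rfl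

@[simp] theorem roseVec_leaf (F : ℕ → ℝ) (c : ℝ) (Y : Fin p → ℝ) (j : Fin p) :
    roseVec s t p F c Y (Sum.inr (Sum.inr j)) = Y j := rfl

theorem exists_eq_roseVec (Φ : Fin (s + t + 1) ⊕ (Unit ⊕ Fin p) → ℝ) :
    ∃ F c Y, Φ = roseVec s t p F c Y := by
  refine ⟨fun i => if h : i < s + t + 1 then Φ (Sum.inl ⟨i, h⟩) else 0,
    Φ (Sum.inr (Sum.inl ())), fun j => Φ (Sum.inr (Sum.inr j)), ?_⟩
  funext v
  rcases v with i | ⟨⟨⟩ | j⟩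
  · rw [roseVec_inl, dif_pos i.isLt]
  · rfl
  · rfl

theorem SimpleGraph.lapMatrix_mulVec_apply_eq_sum {V : Type*} [Fintype V] [DecidableEq V]
    (G : SimpleGraph V) [DecidableRel G.Adj] (Φ : V → ℝ) (v : V) :
    (G.lapMatrix ℝ).mulVec Φ v = ∑ u, if G.Adj v u then Φ v - Φ u else 0 := by
  rw [SimpleGraph.lapMatrix_mulVec_apply, SimpleGraph.degree_eq_sum_if_adj, Finset.sum_mul,
    SimpleGraph.neighborFinset_eq_filter, Finset.sum_filter, ← Finset.sum_sub_distrib]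
  refine Finset.sum_congr rfl fun u _ => ?_
  split_ifs <;> simp

theorem roseTree_lap_inl (F : ℕ → ℝ) (c : ℝ) (Y : Fin p → ℝ) (i : Fin (s + t + 1)) :
    ((roseTree s t p).lapMatrix ℝ).mulVec (roseVec s t p F c Y) (Sum.inl i) =
      (if i.val < s + t then F i - F (i + 1) else 0) +
      (if 0 < i.val then F i - F (i - 1) else 0) + (if i.val = s then F i - c else 0) := by
  rw [SimpleGraph.lapMatrix_mulVec_apply_eq_sum, Fintype.sum_sum_type, Fintype.sum_sum_type]
  simp only [roseTree_adj_inl_inl, roseVec_inl, Finset.univ_unique, Finset.sum_singleton,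
    PUnit.default_eq_unit, roseTree_adj_inl_center, roseVec_center, not_roseTree_adj_inl_leaf,
    if_false, Finset.sum_const_zero, add_zero]
  congr 1
  have hsplit : ∀ j : Fin (s + t + 1),
      (if i.val + 1 = j.val ∨ j.val + 1 = i.val then F i - F j else 0) =
      (if i.val + 1 = j.val then F i - F (i + 1) else 0) +
      (if j.val + 1 = i.val then F i - F (i - 1) else 0) := by
    intro j
    by_cases h1 : i.val + 1 = j.val
    · have h2 : ¬ j.val + 1 = i.val := by omega
      simp [h1]; omega
    · by_cases h2 : j.val + 1 = i.val
      · simp [← h2]; omega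
      · simp [h1, h2]
  simp only [hsplit, Finset.sum_add_distrib]
  congr 1
  · by_cases h : i.val < s + t
    · rw [if_pos h, Finset.sum_eq_single (⟨i + 1, by omega⟩ : Fin (s + t + 1))]
      · simp
      · intro b _ hb
        rw [if_neg]
        intro h'
        exact hb (Fin.ext (by simp [h']))
      · simp
    · rw [if_neg h]
      refine Finset.sum_eq_zero fun j _ => if_neg ?_
      omega
  · by_cases h : 0 < i.val
    · rw [if_pos h, Finset.sum_eq_single (⟨i - 1, by omega⟩ : Fin (s + t + 1))]
      · rw [if_pos]; simp; omega
      · intro b _ hb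
        rw [if_neg]
        intro h'
        exact hb (Fin.ext (by simp [← h']))
      · simp
    · rw [if_neg h]
      refine Finset.sum_eq_zero fun j _ => if_neg ?_
      omega

theorem roseTree_lap_center (F : ℕ → ℝ) (c : ℝ) (Y : Fin p → ℝ) (u : Unit) :
    ((roseTree s t p).lapMatrix ℝ).mulVec (roseVec s t p F c Y) (Sum.inr (Sum.inl u)) =
      (c - F s) + ∑ j, (c - Y j) := by
  rw [SimpleGraph.lapMatrix_mulVec_apply_eq_sum, Fintype.sum_sum_type, Fintype.sum_sum_type]
  rw [Finset.sum_eq_single (⟨s, by omega⟩ : Fin (s + t + 1))]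
  · simp
  · intro b _ hb
    rw [if_neg]
    rw [roseTree_adj_center_inl]
    exact fun h' => hb (Fin.ext h')
  · simp

theorem roseTree_lap_leaf (F : ℕ → ℝ) (c : ℝ) (Y : Fin p → ℝ) (j : Fin p) :
    ((roseTree s t p).lapMatrix ℝ).mulVec (roseVec s t p F c Y) (Sum.inr (Sum.inr j)) =
      Y j - c := by
  rw [SimpleGraph.lapMatrix_mulVec_apply_eq_sum, Fintype.sum_sum_type, Fintype.sum_sum_type]
  simp

end RoseTree

/-! ### The path recursion -/

/-- The solution `P₀, P₁, …` of the eigenvector equation with eigenvalue `x` along a path that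
starts at an end vertex, normalized by `P₀ = 1`. -/
noncomputable def pathSol (x : ℝ) : ℕ → ℝ
  | 0 => 1
  | 1 => 1 - x
  | k + 2 => (2 - x) * pathSol x (k + 1) - pathSol x k

@[simp] theorem pathSol_zero (x : ℝ) : pathSol x 0 = 1 := by rw [pathSol]

@[simp] theorem pathSol_one (x : ℝ) : pathSol x 1 = 1 - x := by rw [pathSol]

theorem pathSol_add_two (x : ℝ) (k : ℕ) :
    pathSol x (k + 2) = (2 - x) * pathSol x (k + 1) - pathSol x k := by rw [pathSol]

theorem cos_half_mul_pathSol (θ : ℝ) (k : ℕ) :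
    Real.cos (θ / 2) * pathSol (2 * (1 - Real.cos θ)) k = Real.cos ((k + 1 / 2) * θ) := by
  have key : ∀ A : ℝ, Real.cos (A + θ) = 2 * Real.cos θ * Real.cos A - Real.cos (A - θ) := by
    intro A; rw [Real.cos_add, Real.cos_sub]; ring
  induction k using Nat.twoStepInduction with
  | zero => simp; ring_nf
  | one =>
    have h := key (θ / 2)
    rw [show θ / 2 - θ = -(θ / 2) by ring, Real.cos_neg] at h
    rw [show ((1 : ℕ) + 1 / 2 : ℝ) * θ = θ / 2 + θ by push_cast; ring, h, pathSol_one]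
    ring
  | more k h1 h2 =>
    have h := key ((((k + 1 : ℕ) : ℝ) + 1 / 2) * θ)
    rw [show (((k + 2 : ℕ) : ℝ) + 1 / 2) * θ = (((k + 1 : ℕ) : ℝ) + 1 / 2) * θ + θ by
      push_cast; ring, h, show (((k + 1 : ℕ) : ℝ) + 1 / 2) * θ - θ = ((k : ℝ) + 1 / 2) * θ by
      push_cast; ring, ← h1, ← h2, pathSol_add_two]
    ring

theorem pathSol_pred_ne_zero {x : ℝ} : ∀ {k : ℕ}, pathSol x (k + 1) = 0 → pathSol x k ≠ 0
  | 0, _ => by simp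
  | k + 1, h => fun h' => pathSol_pred_ne_zero h' (by rw [pathSol_add_two, h'] at h; linarith)

theorem roseRadius_angle (s : ℕ) :
    0 < Real.pi / (2 * (s : ℝ) + 1) ∧ Real.pi / (2 * (s : ℝ) + 1) ≤ Real.pi := by
  have := Real.pi_pos
  exact ⟨by positivity, div_le_self this.le (by linarith [Nat.cast_nonneg (α := ℝ) s])⟩

theorem roseRadius_pos (s : ℕ) : 0 < roseRadius s := by
  obtain ⟨h0, h1⟩ := roseRadius_angle s
  have := Real.cos_lt_cos_of_nonneg_of_le_pi le_rfl h1 h0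
  rw [Real.cos_zero] at this
  rw [roseRadius]; linarith

theorem roseRadius_lt_one {s : ℕ} (hs : 3 ≤ s) : roseRadius s < 1 := by
  obtain ⟨h0, h1⟩ := roseRadius_angle s
  have hs' : (3 : ℝ) ≤ s := by exact_mod_cast hs
  have hlt : Real.pi / (2 * (s : ℝ) + 1) < Real.pi / 3 :=
    div_lt_div_of_pos_left Real.pi_pos (by norm_num) (by linarith)
  have := Real.cos_lt_cos_of_nonneg_of_le_pi h0.le (by linarith [Real.pi_pos]) hlt
  rw [Real.cos_pi_div_three] at this
  rw [roseRadius]; linarith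

theorem pathSol_pos_of_lt_roseRadius {s k : ℕ} {x : ℝ} (hx0 : 0 ≤ x) (hx : x < roseRadius s)
    (hk : k ≤ s) : 0 < pathSol x k := by
  obtain ⟨h0, h1⟩ := roseRadius_angle s
  have hr : roseRadius s = 2 * (1 - Real.cos (Real.pi / (2 * (s : ℝ) + 1))) := rfl
  have hc := Real.neg_one_le_cos (Real.pi / (2 * (s : ℝ) + 1))
  set θ := Real.arccos (1 - x / 2) with hθ
  have hcos : Real.cos θ = 1 - x / 2 := Real.cos_arccos (by linarith) (by linarith)
  have hθlt : θ < Real.pi / (2 * (s : ℝ) + 1) := by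
    by_contra! h
    have := Real.cos_le_cos_of_nonneg_of_le_pi h0.le (Real.arccos_le_pi _) h
    rw [← hθ, hcos] at this
    linarith
  have hθ0 : 0 ≤ θ := Real.arccos_nonneg _
  have hmul := cos_half_mul_pathSol θ k
  rw [hcos, show 2 * (1 - (1 - x / 2)) = x by ring] at hmul
  have hpi : θ * (2 * (s : ℝ) + 1) < Real.pi := by
    rwa [lt_div_iff₀ (by positivity)] at hθlt
  have hk' : (k : ℝ) ≤ s := by exact_mod_cast hk
  have hkθ : (k : ℝ) * θ ≤ s * θ := mul_le_mul_of_nonneg_right hk' hθ0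
  have hk0 : 0 ≤ (k : ℝ) * θ := by positivity
  have p1 : 0 < Real.cos (θ / 2) := Real.cos_pos_of_mem_Ioo ⟨by linarith [Real.pi_pos], by linarith⟩
  have p2 : 0 < Real.cos ((k + 1 / 2) * θ) :=
    Real.cos_pos_of_mem_Ioo ⟨by nlinarith [Real.pi_pos], by nlinarith⟩
  rw [← hmul] at p2
  exact (mul_pos_iff_of_pos_left p1).1 p2

theorem pathSol_roseRadius (s : ℕ) (hs : 1 ≤ s) : pathSol (roseRadius s) s = 0 := by
  have h := cos_half_mul_pathSol (Real.pi / (2 * (s : ℝ) + 1)) s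
  have hs' : (1 : ℝ) ≤ s := by exact_mod_cast hs
  have hpi := Real.pi_pos
  rw [show ((s : ℝ) + 1 / 2) * (Real.pi / (2 * (s : ℝ) + 1)) = Real.pi / 2 by field_simp,
    Real.cos_pi_div_two] at h
  obtain ⟨h0, h1⟩ := roseRadius_angle s
  have : Real.pi / (2 * (s : ℝ) + 1) < Real.pi := div_lt_self hpi (by linarith)
  refine (mul_eq_zero.1 h).resolve_left (Real.cos_pos_of_mem_Ioo ⟨?_, ?_⟩).ne' <;> linarith

theorem pathSol_roseRadius_succ_lt {s k : ℕ} (hk : k < s) :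
    pathSol (roseRadius s) (k + 1) < pathSol (roseRadius s) k := by
  obtain ⟨h0, h1⟩ := roseRadius_angle s
  have hpi := Real.pi_pos
  set θ := Real.pi / (2 * (s : ℝ) + 1) with hθ
  have hk' : (k : ℝ) + 1 ≤ s := by exact_mod_cast hk
  have hθs : θ * (2 * (s : ℝ) + 1) = Real.pi := div_mul_cancel₀ _ (by positivity)
  have hkθ : ((k : ℝ) + 1) * θ ≤ s * θ := mul_le_mul_of_nonneg_right hk' h0.le
  have hk0 : 0 ≤ (k : ℝ) * θ := by positivity
  have p1 : 0 < Real.cos (θ / 2) := Real.cos_pos_of_mem_Ioo ⟨by linarith, by nlinarith⟩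
  have hlt : Real.cos ((((k + 1 : ℕ) : ℝ) + 1 / 2) * θ) < Real.cos (((k : ℝ) + 1 / 2) * θ) := by
    refine Real.cos_lt_cos_of_nonneg_of_le_pi (by positivity) ?_ ?_
    · push_cast; nlinarith
    · push_cast; nlinarith
  rw [← cos_half_mul_pathSol, ← cos_half_mul_pathSol] at hlt
  exact lt_of_mul_lt_mul_left hlt p1.le

theorem pathSol_roseRadius_lt {s j k : ℕ} (hjk : j < k) (hk : k ≤ s) :
    pathSol (roseRadius s) k < pathSol (roseRadius s) j := by
  induction k, hjk using Nat.le_induction with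
  | base => exact pathSol_roseRadius_succ_lt hk
  | succ k hjk ih => exact (pathSol_roseRadius_succ_lt hk).trans (ih (by omega))

/-- While the path solution stays positive it is decreasing from `1`, so its `k`-th increment is
at least `-k x`; summing these gives a bound that is linear in `x`. -/
theorem pathSol_ge {x : ℝ} (hx : 0 ≤ x) (k : ℕ) (hpos : ∀ j < k, 0 < pathSol x j) :
    1 - k * (k + 1) / 2 * x ≤ pathSol x k := by
  have key : ∀ n, (∀ j < n, 0 < pathSol x j) →
      pathSol x n ≤ 1 ∧ 1 - n * (n + 1) / 2 * x ≤ pathSol x n ∧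
      ((∀ j < n + 1, 0 < pathSol x j) → pathSol x (n + 1) - pathSol x n ≤ 0 ∧
        -((n : ℝ) + 1) * x ≤ pathSol x (n + 1) - pathSol x n) := by
    intro n
    induction n with
    | zero => intro _; simp [hx]
    | succ n ih =>
      intro h
      obtain ⟨h1, h2, h3⟩ := ih fun j hj => h j (by omega)
      obtain ⟨h4, h5⟩ := h3 h
      have h6 : pathSol x (n + 1) ≤ 1 := by linarith
      refine ⟨h6, ?_, fun h' => ?_⟩
      · push_cast
        linarith
      · have h7 := h' (n + 1) (by omega)
        rw [pathSol_add_two]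
        have h8 := mul_nonneg hx h7.le
        have h9 := mul_le_mul_of_nonneg_left h6 hx
        push_cast
        constructor <;> linarith
  exact (key k hpos).2.1

/-! ### The Dirichlet polynomial of the star -/

/-- For odd `n ≥ 7` the residues `±1, ±2, ±4` modulo `n` are distinct units. -/
theorem six_le_totient {s : ℕ} (hs : 3 ≤ s) : 6 ≤ Nat.totient (4 * s + 2) := by
  obtain ⟨m, rfl⟩ := Nat.exists_eq_add_of_le hs
  have hodd : Nat.Coprime (2 * m + 7) 2 := by
    rw [Nat.coprime_two_right]; exact ⟨m + 3, by ring⟩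
  have hodd4 : Nat.Coprime (2 * m + 7) 4 := hodd.pow_right 2
  rw [show 4 * (3 + m) + 2 = (2 * m + 7) * 2 by ring, Nat.totient_mul hodd, Nat.totient_two,
    mul_one, Nat.totient_eq_card_coprime]
  have hsub : ({1, 2, 4, 2 * m + 3, 2 * m + 5, 2 * m + 6} : Finset ℕ) ⊆
      (Finset.range (2 * m + 7)).filter fun a => Nat.Coprime (2 * m + 7) a := by
    intro a ha
    simp only [Finset.mem_insert, Finset.mem_singleton] at ha
    rw [Finset.mem_filter, Finset.mem_range]
    rcases ha with rfl | rfl | rfl | rfl | rfl | rfl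
    · exact ⟨by omega, Nat.coprime_one_right _⟩
    · exact ⟨by omega, hodd⟩
    · exact ⟨by omega, hodd4⟩
    · refine ⟨by omega, ?_⟩
      have := (Nat.coprime_self_sub_right (n := 2 * m + 7) (m := 4) (by omega)).2 hodd4
      simpa using this
    · refine ⟨by omega, ?_⟩
      have := (Nat.coprime_self_sub_right (n := 2 * m + 7) (m := 2) (by omega)).2 hodd
      simpa using this
    · refine ⟨by omega, ?_⟩
      have := (Nat.coprime_self_sub_right (n := 2 * m + 7) (m := 1) (by omega)).2
        (Nat.coprime_one_right _)
      simpa using this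
  have hcard : ({1, 2, 4, 2 * m + 3, 2 * m + 5, 2 * m + 6} : Finset ℕ).card = 6 := by
    rw [Finset.card_insert_of_notMem, Finset.card_insert_of_notMem, Finset.card_insert_of_notMem,
      Finset.card_insert_of_notMem, Finset.card_insert_of_notMem, Finset.card_singleton] <;>
    simp only [Finset.mem_insert, Finset.mem_singleton, not_or] <;> omega
  exact hcard ▸ Finset.card_le_card hsub

/-- `1 - (p + 2) x + x ^ 2` vanishes at the eigenvalues of the star branch with a Dirichlet
condition at the path. It has no root of the form `roseRadius s`: with `ζ = exp (i π / (2 s + 1))`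
one has `roseRadius s = 2 - ζ - ζ⁻¹`, so a root would make `ζ` a zero of a monic integral
polynomial of degree `4`, whereas `ζ` has degree `φ (4 s + 2) ≥ 6`. -/
theorem roseQuad_roseRadius_ne_zero {s : ℕ} (hs : 3 ≤ s) (p : ℕ) :
    1 - (p + 2) * roseRadius s + roseRadius s ^ 2 ≠ 0 := by
  intro h
  set ζ : ℂ := Complex.exp (2 * Real.pi * Complex.I / ((4 * s + 2 : ℕ) : ℂ)) with hζ
  have hprim : IsPrimitiveRoot ζ (4 * s + 2) := Complex.isPrimitiveRoot_exp _ (by omega)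
  have hζ0 : ζ ≠ 0 := Complex.exp_ne_zero _
  have hr : (roseRadius s : ℂ) * ζ = 2 * ζ - ζ ^ 2 - 1 := by
    have harg : 2 * Real.pi * Complex.I / ((4 * s + 2 : ℕ) : ℂ) =
        (Real.pi / (2 * s + 1) : ℂ) * Complex.I := by
      have : (2 * (s : ℂ) + 1) ≠ 0 := by exact_mod_cast (by omega : 2 * s + 1 ≠ 0)
      push_cast
      rw [show (4 * (s : ℂ) + 2) = 2 * (2 * s + 1) by ring]
      field_simp
    have hinv : ζ⁻¹ = Complex.exp (-(Real.pi / (2 * s + 1) : ℂ) * Complex.I) := by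
      rw [hζ, harg, ← Complex.exp_neg]; ring_nf
    have hcos : (Complex.cos (Real.pi / (2 * s + 1) : ℂ)) = (ζ + ζ⁻¹) / 2 := by
      rw [hinv, hζ, harg, Complex.cos]
    rw [roseRadius]
    push_cast
    rw [hcos]
    field_simp
    ring
  let f : Polynomial ℤ := Polynomial.X ^ 4 + (Polynomial.C ((p : ℤ) - 2) * Polynomial.X ^ 3 +
    Polynomial.C (3 - 2 * (p : ℤ)) * Polynomial.X ^ 2 + Polynomial.C ((p : ℤ) - 2) * Polynomial.X
    + Polynomial.C 1)
  have hf0 : f.Monic := by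
    refine Polynomial.monic_X_pow_add (n := 4) ?_
    refine lt_of_le_of_lt Polynomial.degree_cubic_le (by norm_num)
  have hdeg : f.natDegree ≤ 4 := by
    simp only [f]; compute_degree
  have hroot : Polynomial.aeval ζ f = 0 := by
    have hC : (1 - (p + 2) * (roseRadius s : ℂ) + (roseRadius s : ℂ) ^ 2) = 0 := by
      exact_mod_cast congrArg (fun x : ℝ => (x : ℂ)) h
    have h2 : ζ ^ 2 - (p + 2) * ((roseRadius s : ℂ) * ζ) * ζ + ((roseRadius s : ℂ) * ζ) ^ 2 = 0 := by
      linear_combination ζ ^ 2 * hC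
    rw [hr] at h2
    simp only [f, map_add, map_mul, map_pow, Polynomial.aeval_X, Polynomial.aeval_C]
    simp only [algebraMap_int_eq, Int.coe_castRingHom]
    push_cast
    linear_combination h2
  have hint : IsIntegral ℤ ζ := ⟨f, hf0, by simpa [Polynomial.aeval_def] using hroot⟩
  have h4 : (minpoly ℤ ζ).natDegree ≤ f.natDegree :=
    Polynomial.natDegree_le_of_dvd (minpoly.isIntegrallyClosed_dvd hint hroot) hf0.ne_zero
  have h5 := hprim.totient_le_degree_minpoly
  have h6 := six_le_totient hs
  omega

/-! ### Eigenvectors of the Rose tree -/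

section Eigenvectors

variable {s t p : ℕ} {x : ℝ} {F : ℕ → ℝ} {c : ℝ} {Y : Fin p → ℝ}

theorem roseVec_eigen_left
    (h : ((roseTree s t p).lapMatrix ℝ).mulVec (roseVec s t p F c Y) = x • roseVec s t p F c Y)
    {k : ℕ} (hk : k ≤ s) : F k = F 0 * pathSol x k := by
  induction k using Nat.twoStepInduction with
  | zero => simp
  | one =>
    have h1 := congrFun h (Sum.inl ⟨0, by omega⟩)
    rw [roseTree_lap_inl, if_pos (by simp only; omega), if_neg (by simp),
      if_neg (by simp only; omega)] at h1
    simp only [Pi.smul_apply, roseVec_inl, smul_eq_mul, zero_add, add_zero] at h1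
    rw [pathSol_one]; linarith
  | more k ih1 ih2 =>
    have h1 := congrFun h (Sum.inl ⟨k + 1, by omega⟩)
    rw [roseTree_lap_inl, if_pos (by simp only; omega), if_pos (by simp),
      if_neg (by simp only; omega)] at h1
    simp only [Pi.smul_apply, roseVec_inl, smul_eq_mul, add_zero, Nat.add_sub_cancel] at h1
    rw [ih1 (by omega), ih2 (by omega)] at h1
    rw [pathSol_add_two]
    linarith

theorem roseVec_eigen_right
    (h : ((roseTree s t p).lapMatrix ℝ).mulVec (roseVec s t p F c Y) = x • roseVec s t p F c Y)
    {k : ℕ} (hk : k ≤ t) : F (s + t - k) = F (s + t) * pathSol x k := by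
  induction k using Nat.twoStepInduction with
  | zero => simp
  | one =>
    have h1 := congrFun h (Sum.inl ⟨s + t, by omega⟩)
    rw [roseTree_lap_inl, if_neg (by simp), if_pos (by simp only; omega),
      if_neg (by simp only; omega)] at h1
    simp only [Pi.smul_apply, roseVec_inl, smul_eq_mul, zero_add, add_zero] at h1
    rw [pathSol_one]; linarith
  | more k ih1 ih2 =>
    have h1 := congrFun h (Sum.inl ⟨s + t - (k + 1), by omega⟩)
    rw [roseTree_lap_inl, if_pos (by simp only; omega), if_pos (by simp only; omega),
      if_neg (by simp only; omega)] at h1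
    simp only [Pi.smul_apply, roseVec_inl, smul_eq_mul, add_zero] at h1
    rw [show s + t - (k + 1) + 1 = s + t - k by omega,
      show s + t - (k + 1) - 1 = s + t - (k + 2) by omega,
      ih1 (by omega), ih2 (by omega)] at h1
    rw [pathSol_add_two]
    linarith

theorem roseVec_eigen_leaf
    (h : ((roseTree s t p).lapMatrix ℝ).mulVec (roseVec s t p F c Y) = x • roseVec s t p F c Y)
    (j : Fin p) : (1 - x) * Y j = c := by
  have h1 := congrFun h (Sum.inr (Sum.inr j))
  rw [roseTree_lap_leaf] at h1
  simp only [Pi.smul_apply, roseVec_leaf, smul_eq_mul] at h1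
  linarith

theorem roseVec_eigen_center
    (h : ((roseTree s t p).lapMatrix ℝ).mulVec (roseVec s t p F c Y) = x • roseVec s t p F c Y) :
    (1 - x) * F s = c * (1 - (p + 2) * x + x ^ 2) := by
  have h1 := congrFun h (Sum.inr (Sum.inl ()))
  rw [roseTree_lap_center] at h1
  simp only [Pi.smul_apply, roseVec_center, smul_eq_mul, Finset.sum_sub_distrib,
    Finset.sum_const, Finset.card_univ, Fintype.card_fin, nsmul_eq_mul] at h1
  have h2 : (1 - x) * ∑ j, Y j = p * c := by
    rw [Finset.mul_sum, Finset.sum_congr rfl fun j _ => roseVec_eigen_leaf h j]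
    simp
  linear_combination (-(1 - x)) * h1 - h2

theorem roseVec_eigen_branch (hs : 1 ≤ s) (ht : 1 ≤ t)
    (h : ((roseTree s t p).lapMatrix ℝ).mulVec (roseVec s t p F c Y) = x • roseVec s t p F c Y) :
    (3 - x) * F s = F 0 * pathSol x (s - 1) + F (s + t) * pathSol x (t - 1) + c := by
  have h1 := congrFun h (Sum.inl ⟨s, by omega⟩)
  rw [roseTree_lap_inl, if_pos (by simp only; omega), if_pos (by simp only; omega),
    if_pos rfl] at h1
  simp only [Pi.smul_apply, roseVec_inl, smul_eq_mul] at h1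
  have h2 := roseVec_eigen_left h (k := s - 1) (by omega)
  have h3 := roseVec_eigen_right h (k := t - 1) (by omega)
  rw [show s + t - (t - 1) = s + 1 by omega] at h3
  rw [← h2, ← h3]
  linarith

theorem roseVec_eigen_eq_zero (hx : x ≠ 1)
    (h : ((roseTree s t p).lapMatrix ℝ).mulVec (roseVec s t p F c Y) = x • roseVec s t p F c Y)
    (h0 : F 0 = 0) (hst : F (s + t) = 0) (hc : c = 0) : roseVec s t p F c Y = 0 := by
  funext v
  rcases v with i | u | j
  · simp only [roseVec_inl, Pi.zero_apply]
    rcases le_total i.val s with hi | hi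
    · rw [roseVec_eigen_left h hi, h0, zero_mul]
    · have := roseVec_eigen_right h (k := s + t - i.val) (by omega)
      rwa [show s + t - (s + t - i.val) = i.val by omega, hst, zero_mul] at this
  · exact hc
  · have := roseVec_eigen_leaf h j
    rw [hc] at this
    exact (mul_eq_zero.1 this).resolve_left (sub_ne_zero.2 hx.symm)

/-- Unless `x` is a Dirichlet eigenvalue of all three branches at the vertex `s`, an eigenvector
for `x` is determined by its value at one well-chosen vertex, so the eigenspace is at most a
line. -/
theorem roseTree_exists_faithful_vertex (hs : 1 ≤ s) (ht : 1 ≤ t) (hx : x ≠ 1)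
    (hne : pathSol x s ≠ 0 ∨ pathSol x t ≠ 0 ∨ 1 - (p + 2) * x + x ^ 2 ≠ 0) :
    ∃ v, ∀ Φ, ((roseTree s t p).lapMatrix ℝ).mulVec Φ = x • Φ → Φ v = 0 → Φ = 0 := by
  have hx1 : 1 - x ≠ 0 := sub_ne_zero.2 hx.symm
  have hpred : ∀ n, 1 ≤ n → pathSol x n = 0 → pathSol x (n - 1) ≠ 0 := fun n hn h => by
    obtain ⟨m, rfl⟩ := Nat.exists_eq_add_of_le' hn
    exact pathSol_pred_ne_zero h
  -- The equation at `s` recovers the value at the center from the values at the two ends.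
  have hends : ∀ F c Y, ((roseTree s t p).lapMatrix ℝ).mulVec (roseVec s t p F c Y) =
      x • roseVec s t p F c Y → F 0 = 0 → F (s + t) = 0 → roseVec s t p F c Y = 0 := by
    intro F c Y h h0 hst
    have h1 := roseVec_eigen_left h le_rfl
    rw [h0, zero_mul] at h1
    have h2 := roseVec_eigen_branch hs ht h
    rw [h1, h0, hst] at h2
    exact roseVec_eigen_eq_zero hx h h0 hst (by linarith)
  by_cases hPs : pathSol x s = 0
  · refine ⟨Sum.inl ⟨0, by omega⟩, fun Φ h h0 => ?_⟩
    obtain ⟨F, c, Y, rfl⟩ := exists_eq_roseVec Φ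
    simp only [roseVec_inl] at h0
    have h1 := roseVec_eigen_left h le_rfl
    rw [h0, zero_mul] at h1
    have h2 := roseVec_eigen_right h le_rfl
    rw [Nat.add_sub_cancel, h1] at h2
    by_cases hPt : pathSol x t = 0
    · have hq := (hne.resolve_left (not_not.2 hPs)).resolve_left (not_not.2 hPt)
      have h3 := roseVec_eigen_center h
      rw [h1, mul_zero] at h3
      have hc := (mul_eq_zero.1 h3.symm).resolve_right hq
      have h4 := roseVec_eigen_branch hs ht h
      rw [h1, h0, hc, mul_zero, zero_mul, zero_add, add_zero] at h4
      exact hends F c Y h h0 ((mul_eq_zero.1 h4.symm).resolve_right (hpred t ht hPt))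
    · exact hends F c Y h h0 ((mul_eq_zero.1 h2.symm).resolve_right hPt)
  · by_cases hPt : pathSol x t = 0
    · refine ⟨Sum.inl ⟨s + t, by omega⟩, fun Φ h hst => ?_⟩
      obtain ⟨F, c, Y, rfl⟩ := exists_eq_roseVec Φ
      simp only [roseVec_inl] at hst
      have h2 := roseVec_eigen_right h le_rfl
      rw [Nat.add_sub_cancel, hst, zero_mul] at h2
      have h1 := roseVec_eigen_left h le_rfl
      rw [h2] at h1
      exact hends F c Y h ((mul_eq_zero.1 h1.symm).resolve_right hPs) hst
    · refine ⟨Sum.inl ⟨s, by omega⟩, fun Φ h hF => ?_⟩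
      obtain ⟨F, c, Y, rfl⟩ := exists_eq_roseVec Φ
      simp only [roseVec_inl] at hF
      have h1 := roseVec_eigen_left h le_rfl
      have h2 := roseVec_eigen_right h le_rfl
      rw [Nat.add_sub_cancel] at h2
      rw [hF] at h1 h2
      exact hends F c Y h ((mul_eq_zero.1 h1.symm).resolve_right hPs)
        ((mul_eq_zero.1 h2.symm).resolve_right hPt)

end Eigenvectors

/-! ### Test vectors on the three branches -/

theorem dotProduct_le_of_forall {V : Type*} [Fintype V] {f g : V → ℝ} {x : ℝ}
    (h : ∀ v, f v * g v ≤ x * (f v * f v)) : f ⬝ᵥ g ≤ x * (f ⬝ᵥ f) := by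
  simp only [dotProduct, Finset.mul_sum]
  exact Finset.sum_le_sum fun v _ => h v

section TestVectors

variable {s t p : ℕ} {x : ℝ}

theorem exists_first_nonpos {n : ℕ} (h : ∃ k ≤ n, pathSol x k ≤ 0) :
    ∃ k, k + 1 ≤ n ∧ pathSol x (k + 1) ≤ 0 ∧ ∀ j ≤ k, 0 < pathSol x j := by
  classical
  have hex : ∃ k, pathSol x k ≤ 0 := ⟨_, h.choose_spec.2⟩
  have hle : Nat.find hex ≤ n := (Nat.find_min' hex h.choose_spec.2).trans h.choose_spec.1
  have hspec := Nat.find_spec hex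
  have hmin : ∀ m, m < Nat.find hex → ¬ pathSol x m ≤ 0 := fun m hm => Nat.find_min hex hm
  generalize Nat.find hex = m at hle hspec hmin
  cases m with
  | zero => rw [pathSol_zero] at hspec; linarith
  | succ k => exact ⟨k, hle, hspec, fun j hj => not_le.1 (hmin j (by omega))⟩

/-- A path solution cut off just before its first nonpositive value satisfies the eigenvalue
inequality on its support. -/
theorem truncated_pathSol_mul_le {k : ℕ} (hk : pathSol x (k + 1) ≤ 0)
    (hpos : ∀ j ≤ k, 0 < pathSol x j) {T : ℕ → ℝ}
    (hT : ∀ i, T i = if i ≤ k then pathSol x i else 0) (i : ℕ) :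
    T i * (T i - T (i + 1) + if 0 < i then T i - T (i - 1) else 0) ≤ x * (T i * T i) := by
  by_cases hi : i ≤ k
  · have hPi := hpos i hi
    have h0 : T i = pathSol x i := by rw [hT, if_pos hi]
    have h1 : pathSol x (i + 1) ≤ T (i + 1) := by
      rw [hT]
      rcases hi.lt_or_eq with hlt | rfl
      · rw [if_pos (by omega)]
      · rw [if_neg (by omega)]; exact hk
    rw [h0]
    suffices h : pathSol x i - T (i + 1) + (if 0 < i then pathSol x i - T (i - 1) else 0) ≤
        x * pathSol x i by
      have := mul_le_mul_of_nonneg_left h hPi.le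
      linarith
    rcases i with _ | i
    · simp at h1 ⊢; linarith
    · rw [if_pos (by omega), Nat.add_sub_cancel, hT i, if_pos (by omega)]
      rw [pathSol_add_two] at h1
      linarith
  · rw [hT i, if_neg hi]; simp

/-- If the path solution changes sign along the left arm, its truncation there is a test vector
with Rayleigh quotient at most `x`, supported left of the vertex `s`. -/
theorem exists_left_test (h : ∃ k ≤ s, pathSol x k ≤ 0) :
    ∃ F : ℕ → ℝ, (∀ i, s ≤ i → F i = 0) ∧ 0 < ∑ v, roseVec s t p F 0 0 v ∧
      roseVec s t p F 0 0 ⬝ᵥ ((roseTree s t p).lapMatrix ℝ).mulVec (roseVec s t p F 0 0) ≤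
        x * (roseVec s t p F 0 0 ⬝ᵥ roseVec s t p F 0 0) := by
  obtain ⟨k, hks, hk, hpos⟩ := exists_first_nonpos h
  refine ⟨fun i => if i ≤ k then pathSol x i else 0, fun i hi => if_neg (by omega), ?_, ?_⟩
  · refine Finset.sum_pos' ?_ ⟨Sum.inl ⟨0, by omega⟩, Finset.mem_univ _, by simp⟩
    rintro (i | u | j) -
    · simp only [roseVec_inl]
      split_ifs with hi
      · exact (hpos _ hi).le
      · exact le_rfl
    · exact le_rfl
    · exact le_rfl
  · refine dotProduct_le_of_forall ?_
    rintro (i | u | j)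
    · have hT := truncated_pathSol_mul_le hk hpos (fun _ => rfl) i.val
      rw [roseTree_lap_inl]
      simp only [roseVec_inl]
      by_cases hi : i.val ≤ k
      · rw [if_pos (by omega : i.val < s + t), if_neg (by omega : ¬ i.val = s), add_zero]
        exact hT
      · simp [hi]
    · simp
    · simp

/-- The mirror image of `exists_left_test` on the right arm. -/
theorem exists_right_test (h : ∃ k ≤ t, pathSol x k ≤ 0) :
    ∃ F : ℕ → ℝ, (∀ i, i ≤ s → F i = 0) ∧ 0 < ∑ v, roseVec s t p F 0 0 v ∧
      roseVec s t p F 0 0 ⬝ᵥ ((roseTree s t p).lapMatrix ℝ).mulVec (roseVec s t p F 0 0) ≤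
        x * (roseVec s t p F 0 0 ⬝ᵥ roseVec s t p F 0 0) := by
  obtain ⟨k, hks, hk, hpos⟩ := exists_first_nonpos h
  refine ⟨fun i => if s + t - i ≤ k then pathSol x (s + t - i) else 0,
    fun i hi => if_neg (by omega), ?_, ?_⟩
  · refine Finset.sum_pos' ?_ ⟨Sum.inl ⟨s + t, by omega⟩, Finset.mem_univ _, by simp⟩
    rintro (i | u | j) -
    · simp only [roseVec_inl]
      split_ifs with hi
      · exact (hpos _ hi).le
      · exact le_rfl
    · exact le_rfl
    · exact le_rfl
  · refine dotProduct_le_of_forall ?_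
    rintro (i | u | j)
    · have hT := truncated_pathSol_mul_le hk hpos (fun _ => rfl) (s + t - i.val)
      rw [roseTree_lap_inl]
      simp only [roseVec_inl]
      by_cases hi : s + t - i.val ≤ k
      · rw [if_pos (by omega : 0 < i.val), if_neg (by omega : ¬ i.val = s), add_zero,
          add_comm (ite _ _ _), show s + t - (i.val - 1) = s + t - i.val + 1 by omega,
          show s + t - (i.val + 1) = s + t - i.val - 1 by omega]
        simpa only [tsub_pos_iff_lt] using hT
      · simp [hi]
    · simp
    · simp

/-- On the star take the solution of the eigenvector equation at the leaves. Its defect at the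
center is `1 - (p + 2) x + x ^ 2`. -/
theorem star_test (hx : x < 1) (hq : 1 - (p + 2) * x + x ^ 2 < 0) :
    0 < ∑ v, roseVec s t p 0 (1 - x) 1 v ∧
    roseVec s t p 0 (1 - x) 1 ⬝ᵥ
        ((roseTree s t p).lapMatrix ℝ).mulVec (roseVec s t p 0 (1 - x) 1) <
      x * (roseVec s t p 0 (1 - x) 1 ⬝ᵥ roseVec s t p 0 (1 - x) 1) := by
  have h1 : 0 < 1 - x := by linarith
  constructor
  · simp [Fintype.sum_sum_type]; positivity
  · simp only [dotProduct, Fintype.sum_sum_type, roseTree_lap_inl, roseTree_lap_center,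
      roseTree_lap_leaf, roseVec_inl, roseVec_center, roseVec_leaf]
    simp
    nlinarith [mul_neg_of_pos_of_neg h1 hq]

theorem le_of_left_right {α : ℝ} (hα : IsAlgebraicConnectivity (roseTree s t p) α)
    (hl : ∃ k ≤ s, pathSol x k ≤ 0) (hr : ∃ k ≤ t, pathSol x k ≤ 0) : α ≤ x := by
  obtain ⟨F, hF, hFs, hFl⟩ := exists_left_test (t := t) (p := p) hl
  obtain ⟨G, hG, hGs, hGl⟩ := exists_right_test (s := s) (p := p) hr
  refine (hα.le_and_lt_of_separated (roseTree_connected s t p) hFs hGs ?_ ?_ hFl hGl).1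
  · rintro (i | u | j)
    · rcases le_total i.val s with h | h
      · right; simp [hG _ h]
      · left; simp [hF _ h]
    · simp
    · simp
  · rintro (i | u | j)
    · rcases le_or_gt i.val s with h | h
      · left; simp [hG _ h]
      · right
        rw [roseTree_lap_inl, hF i (by omega), hF (i + 1) (by omega), hF (i - 1) (by omega)]
        simp
    · simp
    · simp

theorem lt_of_left_star {α : ℝ} (hα : IsAlgebraicConnectivity (roseTree s t p) α)
    (hl : ∃ k ≤ s, pathSol x k ≤ 0) (hx : x < 1) (hq : 1 - (p + 2) * x + x ^ 2 < 0) :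
    α < x := by
  obtain ⟨F, hF, hFs, hFl⟩ := exists_left_test (t := t) (p := p) hl
  obtain ⟨hGs, hGl⟩ := star_test (s := s) (t := t) hx hq
  refine (hα.le_and_lt_of_separated (roseTree_connected s t p) hFs hGs ?_ ?_ hFl hGl.le).2 hGl
  · rintro (i | u | j) <;> simp
  · rintro (i | u | j)
    · simp
    · right; rw [roseTree_lap_center, hF s le_rfl]; simp
    · right; rw [roseTree_lap_leaf]; simp

theorem lt_of_right_star {α : ℝ} (hα : IsAlgebraicConnectivity (roseTree s t p) α)
    (hr : ∃ k ≤ t, pathSol x k ≤ 0) (hx : x < 1) (hq : 1 - (p + 2) * x + x ^ 2 < 0) :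
    α < x := by
  obtain ⟨F, hF, hFs, hFl⟩ := exists_right_test (s := s) (p := p) hr
  obtain ⟨hGs, hGl⟩ := star_test (s := s) (t := t) hx hq
  refine (hα.le_and_lt_of_separated (roseTree_connected s t p) hFs hGs ?_ ?_ hFl hGl.le).2 hGl
  · rintro (i | u | j) <;> simp
  · rintro (i | u | j)
    · simp
    · right; rw [roseTree_lap_center, hF s le_rfl]; simp
    · right; rw [roseTree_lap_leaf]; simp

end TestVectors

section Fiedler

/-! ### Uniqueness of the Fiedler vector -/

variable {s t p : ℕ} {α : ℝ}

/-- At `roseRadius (min s t)` the path solution vanishes at distance `min s t` from the end, which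
does not exceed the length of either arm. -/
theorem connectivity_le_roseRadius (hs : 3 ≤ s) (ht : 3 ≤ t)
    (hα : IsAlgebraicConnectivity (roseTree s t p) α) : α ≤ roseRadius (min s t) :=
  have h : pathSol (roseRadius (min s t)) (min s t) ≤ 0 :=
    (pathSol_roseRadius _ (by omega)).le
  le_of_left_right hα ⟨_, min_le_left _ _, h⟩ ⟨_, min_le_right _ _, h⟩

theorem connectivity_lt_one (hs : 3 ≤ s) (ht : 3 ≤ t)
    (hα : IsAlgebraicConnectivity (roseTree s t p) α) : α < 1 :=
  (connectivity_le_roseRadius hs ht hα).trans_lt (roseRadius_lt_one (by omega))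

/-- If the eigenspace had dimension two, the algebraic connectivity would be a Dirichlet eigenvalue
of all three branches. Being at most `roseRadius (min s t)`, it would equal this number, which is
not a Dirichlet eigenvalue of the star. -/
theorem roseTree_hasUniqueFiedlerVector (hs : 3 ≤ s) (ht : 3 ≤ t) :
    HasUniqueFiedlerVector (roseTree s t p) := by
  have : Nontrivial (Fin (s + t + 1) ⊕ (Unit ⊕ Fin p)) :=
    ⟨Sum.inl ⟨0, by omega⟩, Sum.inr (Sum.inl ()), by simp⟩
  refine ⟨(roseTree_connected s t p).exists_isFiedlerVector, fun Φ Ψ hΦ hΨ => ?_⟩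
  obtain ⟨α, hα, hΦe, hΦ0⟩ := isFiedlerVector_iff.1 hΦ
  obtain ⟨β, hβ, hΨe, -⟩ := isFiedlerVector_iff.1 hΨ
  obtain rfl : α = β := hα.unique hβ
  have hne : pathSol α s ≠ 0 ∨ pathSol α t ≠ 0 ∨ 1 - (p + 2) * α + α ^ 2 ≠ 0 := by
    by_contra! h
    obtain ⟨h1, h2, h3⟩ := h
    have hs' : roseRadius s ≤ α := by
      by_contra! hlt
      exact (pathSol_pos_of_lt_roseRadius hα.pos.le hlt le_rfl).ne' h1
    have ht' : roseRadius t ≤ α := by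
      by_contra! hlt
      exact (pathSol_pos_of_lt_roseRadius hα.pos.le hlt le_rfl).ne' h2
    have hle := connectivity_le_roseRadius hs ht hα
    have heq : α = roseRadius (min s t) := by
      rcases min_choice s t with h | h <;> rw [h] at hle ⊢ <;> linarith
    exact roseQuad_roseRadius_ne_zero (s := min s t) (by omega) p (heq ▸ h3)
  obtain ⟨v, hv⟩ := roseTree_exists_faithful_vertex (p := p) (by omega : 1 ≤ s) (by omega : 1 ≤ t)
    (connectivity_lt_one hs ht hα).ne hne
  have hΦv : Φ v ≠ 0 := fun h => hΦ0 (hv Φ hΦe h)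
  refine ⟨Ψ v / Φ v, sub_eq_zero.1 (hv _ ?_ ?_)⟩
  · rw [Matrix.mulVec_sub, Matrix.mulVec_smul, hΦe, hΨe, smul_sub, smul_comm]
  · simp [hΦv]

theorem IsFiedlerVector.neg {V : Type*} [Fintype V] [DecidableEq V] {G : SimpleGraph V}
    [DecidableRel G.Adj] {Φ : V → ℝ} (h : IsFiedlerVector G Φ) : IsFiedlerVector G (-Φ) := by
  obtain ⟨α, hα, he, h0⟩ := isFiedlerVector_iff.1 h
  exact isFiedlerVector_iff.2 ⟨α, hα, by rw [Matrix.mulVec_neg, he, smul_neg], neg_ne_zero.2 h0⟩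

/-! ### Failure of (FED) -/

/-- Since only the two ends of the path are at distance `diam`, (FED) forces the extrema of a
Fiedler vector to be there; they have opposite signs because its entries sum to zero. -/
theorem FED.exists_strict_extrema_at_ends (hs : 3 ≤ s) (ht : 3 ≤ t) (h : FED (roseTree s t p)) :
    ∃ α F c Y, IsAlgebraicConnectivity (roseTree s t p) α ∧
      ((roseTree s t p).lapMatrix ℝ).mulVec (roseVec s t p F c Y) = α • roseVec s t p F c Y ∧
      0 < F 0 ∧ F (s + t) < 0 ∧ ∀ j, Y j < F 0 := by
  obtain ⟨Φ, hΦ, hmax, hmin⟩ : ∃ Φ, IsFiedlerVector (roseTree s t p) Φ ∧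
      (∀ i, i ≠ Sum.inl (⟨0, by omega⟩ : Fin (s + t + 1)) → Φ i < Φ (Sum.inl ⟨0, by omega⟩)) ∧
      (∀ i, i ≠ Sum.inl (⟨s + t, by omega⟩ : Fin (s + t + 1)) →
        Φ (Sum.inl ⟨s + t, by omega⟩) < Φ i) := by
    obtain ⟨Φ, hΦ⟩ := h.1.1
    obtain ⟨m, M, hm, hM, hd⟩ := h.2 Φ hΦ
    rw [roseTree_diam hs ht] at hd
    rcases (roseTree_dist_le_and_eq hs ht m M).2 hd with ⟨rfl, rfl⟩ | ⟨rfl, rfl⟩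
    · exact ⟨-Φ, hΦ.neg, fun i hi => neg_lt_neg (hm i hi), fun i hi => neg_lt_neg (hM i hi)⟩
    · exact ⟨Φ, hΦ, hM, hm⟩
  obtain ⟨α, hα, he, h0⟩ := isFiedlerVector_iff.1 hΦ
  obtain ⟨F, c, Y, rfl⟩ := exists_eq_roseVec Φ
  have hsum := hα.sum_eq_zero he
  refine ⟨α, F, c, Y, hα, he, ?_, ?_, fun j => ?_⟩
  · by_contra! hneg
    refine h0 (funext fun v => ?_)
    have hle : ∀ v ∈ Finset.univ, roseVec s t p F c Y v ≤ 0 := fun v _ => by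
      by_cases hv : v = Sum.inl ⟨0, by omega⟩
      · rw [hv]; exact hneg
      · exact (hmax v hv).le.trans hneg
    exact (Finset.sum_eq_zero_iff_of_nonpos hle).1 hsum v (Finset.mem_univ v)
  · by_contra! hpos
    refine h0 (funext fun v => ?_)
    have hle : ∀ v ∈ Finset.univ, 0 ≤ roseVec s t p F c Y v := fun v _ => by
      by_cases hv : v = Sum.inl ⟨s + t, by omega⟩
      · rw [hv]; exact hpos
      · exact hpos.trans (hmin v hv).le
    exact (Finset.sum_eq_zero_iff_of_nonneg hle).1 hsum v (Finset.mem_univ v)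
  · exact hmax (Sum.inr (Sum.inr j)) (by simp)

/-- For large `p`, uniformly in `t`, a leaf of the star carries a value at least as large as the end
of the left arm that lies on the same side of the nodal point. -/
theorem roseTree_not_FED_of_le (hs : 3 ≤ s) (ht : 3 ≤ t) (hp : s * (s + 1) ≤ 2 * p) :
    ¬ FED (roseTree s t p) := by
  intro hFED
  obtain ⟨α, F, c, Y, hα, he, hF0, hFst, hY⟩ := hFED.exists_strict_extrema_at_ends hs ht
  have hα0 := hα.pos
  have hα1 := connectivity_lt_one hs ht hα
  have hp' : (s : ℝ) * (s + 1) ≤ 2 * p := by exact_mod_cast hp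
  have hq : 1 - (p + 2) * α + α ^ 2 < 1 - s * (s + 1) / 2 * α := by
    have := mul_le_mul_of_nonneg_right hp' hα0.le
    nlinarith
  -- A sign change on the left arm would force `α ≥ 2 / (s (s + 1))`, hence `q(α) < 0` for
  -- `q(x) = 1 - (p + 2) x + x ^ 2`, and the tests on this arm and on the star would push the
  -- connectivity below `α`.
  have hpos : ∀ k ≤ s, 0 < pathSol α k := by
    by_contra! h
    obtain ⟨k, hks, hk, hkpos⟩ := exists_first_nonpos h
    refine (lt_of_left_star hα h hα1 ?_).false
    have h1 := pathSol_ge hα0.le (k + 1) fun j hj => hkpos j (by omega)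
    have hk' : ((k + 1 : ℕ) : ℝ) ≤ s := by exact_mod_cast hks
    have h2 : ((k + 1 : ℕ) : ℝ) * ((k + 1 : ℕ) + 1) ≤ s * (s + 1) := by gcongr
    have h3 := mul_le_mul_of_nonneg_right h2 hα0.le
    linarith
  have hleft := roseVec_eigen_left he le_rfl
  have hright := roseVec_eigen_right he le_rfl
  rw [Nat.add_sub_cancel] at hright
  have hcenter := roseVec_eigen_center he
  have hFs : 0 < F s := hleft ▸ mul_pos hF0 (hpos s le_rfl)
  have hPt : pathSol α t ≤ 0 := by
    by_contra! h
    have := mul_neg_of_neg_of_pos hFst h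
    linarith
  have hq0 : 0 ≤ 1 - (p + 2) * α + α ^ 2 := by
    by_contra! h
    exact (lt_of_right_star hα ⟨t, le_rfl, hPt⟩ hα1 h).false
  have h1α : 0 < 1 - α := by linarith
  have hc : 0 < c := by
    by_contra! h
    have h1 := mul_nonpos_of_nonpos_of_nonneg h hq0
    have h2 := mul_pos h1α hFs
    linarith
  have hp0 : 0 < p := by nlinarith
  have hYle := hY ⟨0, hp0⟩
  have hY0 := roseVec_eigen_leaf he ⟨0, hp0⟩
  set y := Y ⟨0, hp0⟩
  have hy : 0 < y := by
    rw [← hY0] at hc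
    exact (mul_pos_iff_of_pos_left h1α).1 hc
  -- `F s = y * q(α)` and `F s = F 0 * P_s(α)` with `q(α) < P_s(α)`.
  have hFs' : F s = y * (1 - (p + 2) * α + α ^ 2) := by
    refine mul_left_cancel₀ h1α.ne' ?_
    rw [hcenter, ← hY0]; ring
  have hlt : 1 - (p + 2) * α + α ^ 2 < pathSol α s :=
    hq.trans_le (pathSol_ge hα0.le s fun j hj => hpos j hj.le)
  have h1 := mul_lt_mul_of_pos_left hlt hy
  have h2 := mul_lt_mul_of_pos_right hYle (hpos s le_rfl)
  linarith

/-! ### The symmetric Rose tree -/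

/-- If the quadratic is negative, the left arm and the star push the algebraic connectivity strictly
below `roseRadius s`, where the path solution is positive at `s`; the Fiedler vector is then
symmetric and takes the same value at both ends. -/
theorem roseQuad_nonneg_of_FED (hs : 3 ≤ s) (h : FED (roseTree s s p)) :
    0 ≤ 1 - (p + 2) * roseRadius s + roseRadius s ^ 2 := by
  by_contra! hq
  obtain ⟨α, F, c, Y, hα, he, hF0, hFst, -⟩ := h.exists_strict_extrema_at_ends hs hs
  have hlt := lt_of_left_star hα ⟨s, le_rfl, (pathSol_roseRadius s (by omega)).le⟩
    (roseRadius_lt_one hs) hq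
  have hP := pathSol_pos_of_lt_roseRadius hα.pos.le hlt le_rfl
  have hleft := roseVec_eigen_left he le_rfl
  have hright := roseVec_eigen_right he le_rfl
  rw [Nat.add_sub_cancel] at hright
  have h1 := mul_pos hF0 hP
  have h2 := mul_neg_of_neg_of_pos hFst hP
  linarith

/-- Below `roseRadius s` the path solution and the quadratic are both positive, so all entries of an
eigenvector would have the same sign, although they sum to zero. -/
theorem connectivity_eq_roseRadius (hs : 3 ≤ s)
    (hq : 0 < 1 - (p + 2) * roseRadius s + roseRadius s ^ 2)
    (hα : IsAlgebraicConnectivity (roseTree s s p) α) : α = roseRadius s := by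
  have hle := connectivity_le_roseRadius hs hs hα
  rw [min_self] at hle
  refine hle.eq_of_not_lt fun hlt => ?_
  have hα1 := connectivity_lt_one hs hs hα
  have h1α : 0 < 1 - α := by linarith
  have hqα : 0 < 1 - (p + 2) * α + α ^ 2 := by
    have h1 := roseRadius_lt_one hs
    have h2 : 0 < (roseRadius s - α) * (p + 2 - α - roseRadius s) :=
      mul_pos (by linarith) (by linarith [Nat.cast_nonneg (α := ℝ) p])
    linarith
  have hP : ∀ k ≤ s, 0 < pathSol α k := fun k hk =>
    pathSol_pos_of_lt_roseRadius hα.pos.le hlt hk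
  obtain ⟨Φ, hΦ⟩ := hα.1.2.exists_hasEigenvector
  have he : ((roseTree s s p).lapMatrix ℝ).mulVec Φ = α • Φ := by
    have := hΦ.apply_eq_smul; rwa [Matrix.toLin'_apply] at this
  obtain ⟨F, c, Y, rfl⟩ := exists_eq_roseVec Φ
  have hleft := roseVec_eigen_left he le_rfl
  have hright := roseVec_eigen_right he le_rfl
  rw [Nat.add_sub_cancel] at hright
  have hcenter := roseVec_eigen_center he
  have hab : F (s + s) = F 0 := mul_right_cancel₀ (hP s le_rfl).ne' (hright.symm.trans hleft)
  have hc : 0 ≤ F 0 * c := by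
    refine nonneg_of_mul_nonneg_left (b := 1 - (p + 2) * α + α ^ 2) ?_ hqα
    rw [mul_assoc, ← hcenter, hleft]
    have := hP s le_rfl
    have : 0 ≤ (F 0) ^ 2 * ((1 - α) * pathSol α s) := by positivity
    linarith
  have hnn : ∀ v ∈ Finset.univ, 0 ≤ F 0 * roseVec s s p F c Y v := by
    rintro (i | u | j) -
    · simp only [roseVec_inl]
      rcases le_total i.val s with hi | hi
      · rw [roseVec_eigen_left he hi, ← mul_assoc]
        exact mul_nonneg (mul_self_nonneg _) (hP _ hi).le
      · have := roseVec_eigen_right he (k := s + s - i.val) (by omega)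
        rw [show s + s - (s + s - i.val) = i.val by omega, hab] at this
        rw [this, ← mul_assoc]
        exact mul_nonneg (mul_self_nonneg _) (hP _ (by omega)).le
    · exact hc
    · simp only [roseVec_leaf]
      rw [← roseVec_eigen_leaf he j] at hc
      refine nonneg_of_mul_nonneg_right (a := 1 - α) ?_ h1α
      linarith
  have hsum : ∑ v, F 0 * roseVec s s p F c Y v = 0 := by
    rw [← Finset.mul_sum, hα.sum_eq_zero he, mul_zero]
  have h00 := (Finset.sum_eq_zero_iff_of_nonneg hnn).1 hsum (Sum.inl ⟨0, by omega⟩)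
    (Finset.mem_univ _)
  have hF0 : F 0 = 0 := mul_self_eq_zero.1 h00
  rw [hleft, hF0, zero_mul, mul_zero] at hcenter
  exact hΦ.2 (roseVec_eigen_eq_zero hα1.ne he hF0 (hab.trans hF0)
    ((mul_eq_zero.1 hcenter.symm).resolve_right hqα.ne'))

/-- The eigenvectors for `roseRadius s` are antisymmetric: they vanish on the star and decrease in
absolute value from either end to the vertex `s`. -/
theorem roseVec_strict_extrema_of_antisymmetric (hs : 3 ≤ s)
    (hq : 1 - (p + 2) * roseRadius s + roseRadius s ^ 2 ≠ 0)
    {Φ : Fin (s + s + 1) ⊕ (Unit ⊕ Fin p) → ℝ}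
    (he : ((roseTree s s p).lapMatrix ℝ).mulVec Φ = roseRadius s • Φ)
    (h0 : 0 < Φ (Sum.inl ⟨0, by omega⟩)) :
    (∀ i, i ≠ Sum.inl ⟨0, by omega⟩ → Φ i < Φ (Sum.inl ⟨0, by omega⟩)) ∧
    (∀ i, i ≠ Sum.inl ⟨s + s, by omega⟩ → Φ (Sum.inl ⟨s + s, by omega⟩) < Φ i) := by
  obtain ⟨F, c, Y, rfl⟩ := exists_eq_roseVec Φ
  simp only [roseVec_inl] at h0 ⊢
  have hPs := pathSol_roseRadius s (by omega)
  have hr1 := roseRadius_lt_one hs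
  have hFs := roseVec_eigen_left he le_rfl
  rw [hPs, mul_zero] at hFs
  have hcenter := roseVec_eigen_center he
  rw [hFs, mul_zero] at hcenter
  have hc : c = 0 := (mul_eq_zero.1 hcenter.symm).resolve_right hq
  have hb : F (s + s) = -F 0 := by
    have h1 := roseVec_eigen_branch (by omega) (by omega) he
    rw [hFs, hc, mul_zero, add_zero, ← add_mul] at h1
    have h2 : pathSol (roseRadius s) (s - 1) ≠ 0 :=
      (hPs ▸ pathSol_roseRadius_lt (by omega : s - 1 < s) le_rfl).ne'
    have := (mul_eq_zero.1 h1.symm).resolve_right h2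
    linarith
  have hY : ∀ j, Y j = 0 := fun j => by
    have := roseVec_eigen_leaf he j
    rw [hc] at this
    exact (mul_eq_zero.1 this).resolve_left (by linarith)
  have hPnn : ∀ k ≤ s, 0 ≤ pathSol (roseRadius s) k := fun k hk => by
    rcases hk.lt_or_eq with h | rfl
    · exact (hPs ▸ pathSol_roseRadius_lt h le_rfl).le
    · exact hPs.ge
  have hPlt : ∀ k ≤ s, 0 < k → pathSol (roseRadius s) k < 1 := fun k hk hk0 => by
    simpa using pathSol_roseRadius_lt hk0 hk
  -- The values at all other vertices have absolute value less than `F 0`.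
  have hin : ∀ i, i ≠ Sum.inl ⟨0, by omega⟩ → i ≠ Sum.inl ⟨s + s, by omega⟩ →
      roseVec s s p F c Y i < F 0 ∧ -F 0 < roseVec s s p F c Y i := by
    rintro (i | u | j) hi hi'
    · have hi0 : 0 < i.val := Nat.pos_of_ne_zero fun h => hi (by congr 1; exact Fin.ext h)
      have his : i.val < s + s := lt_of_le_of_ne (by omega) fun h => hi' (by congr 1; exact Fin.ext h)
      simp only [roseVec_inl]
      rcases le_total i.val s with h | h
      · have h1 := hPnn _ h
        have h2 := hPlt _ h hi0
        rw [roseVec_eigen_left he h]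
        constructor <;> nlinarith
      · have h1 := hPnn (s + s - i.val) (by omega)
        have h2 := hPlt (s + s - i.val) (by omega) (by omega)
        have h3 := roseVec_eigen_right he (k := s + s - i.val) (by omega)
        rw [show s + s - (s + s - i.val) = i.val by omega, hb] at h3
        rw [h3]
        constructor <;> nlinarith
    · simp [hc, h0]
    · simp [hY, h0]
  constructor
  · intro i hi
    by_cases hi' : i = Sum.inl ⟨s + s, by omega⟩
    · rw [hi', roseVec_inl, hb]; linarith
    · exact (hin i hi hi').1
  · intro i hi'
    rw [hb]
    by_cases hi : i = Sum.inl ⟨0, by omega⟩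
    · rw [hi, roseVec_inl]; simp only; linarith
    · exact (hin i hi hi').2

theorem FED_of_roseQuad_pos (hs : 3 ≤ s)
    (hq : 0 < 1 - (p + 2) * roseRadius s + roseRadius s ^ 2) : FED (roseTree s s p) := by
  refine ⟨roseTree_hasUniqueFiedlerVector hs hs, fun Φ hΦ => ?_⟩
  obtain ⟨α, hα, he, hΦ0⟩ := isFiedlerVector_iff.1 hΦ
  obtain rfl := connectivity_eq_roseRadius hs hq hα
  have hdist : (roseTree s s p).dist (Sum.inl ⟨0, by omega⟩) (Sum.inl ⟨s + s, by omega⟩) =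
      (roseTree s s p).diam := by rw [roseTree_dist_ends, roseTree_diam hs hs]
  rcases lt_trichotomy (Φ (Sum.inl ⟨0, by omega⟩)) 0 with h | h | h
  · have he' : ((roseTree s s p).lapMatrix ℝ).mulVec (-Φ) = roseRadius s • (-Φ) := by
      rw [Matrix.mulVec_neg, he, smul_neg]
    obtain ⟨h1, h2⟩ := roseVec_strict_extrema_of_antisymmetric hs hq.ne' he' (neg_pos.2 h)
    exact ⟨_, _, fun i hi => neg_lt_neg_iff.1 (h1 i hi), fun i hi => neg_lt_neg_iff.1 (h2 i hi),
      hdist⟩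
  · exfalso
    obtain ⟨F, c, Y, rfl⟩ := exists_eq_roseVec Φ
    have hPs := pathSol_roseRadius s (by omega)
    simp only [roseVec_inl] at h
    have hFs := roseVec_eigen_left he le_rfl
    rw [hPs, mul_zero] at hFs
    have hcenter := roseVec_eigen_center he
    rw [hFs, mul_zero] at hcenter
    have hc : c = 0 := (mul_eq_zero.1 hcenter.symm).resolve_right hq.ne'
    have hb := roseVec_eigen_branch (by omega) (by omega) he
    rw [hFs, hc, h, mul_zero, add_zero, zero_mul, zero_add] at hb
    have h2 : pathSol (roseRadius s) (s - 1) ≠ 0 :=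
      (hPs ▸ pathSol_roseRadius_lt (by omega : s - 1 < s) le_rfl).ne'
    exact hΦ0 (roseVec_eigen_eq_zero (roseRadius_lt_one hs).ne he h
      ((mul_eq_zero.1 hb.symm).resolve_right h2) hc)
  · obtain ⟨h1, h2⟩ := roseVec_strict_extrema_of_antisymmetric hs hq.ne' he h
    exact ⟨_, _, h2, h1, by rw [SimpleGraph.dist_comm, hdist]⟩

/-- The threshold `p = (r - 1) ^ 2 / r` is where the quadratic vanishes at `r = roseRadius s`. -/
theorem FED_roseTree_self_iff (hs : 3 ≤ s) :
    FED (roseTree s s p) ↔ (p : ℝ) ≤ (roseRadius s - 1) ^ 2 / roseRadius s := by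
  have hne := roseQuad_roseRadius_ne_zero hs p
  have hiff : (p : ℝ) ≤ (roseRadius s - 1) ^ 2 / roseRadius s ↔
      0 ≤ 1 - (p + 2) * roseRadius s + roseRadius s ^ 2 := by
    rw [le_div_iff₀ (roseRadius_pos s)]
    constructor <;> intro h <;> linarith
  rw [hiff]
  exact ⟨roseQuad_nonneg_of_FED hs, fun h => FED_of_roseQuad_pos hs (lt_of_le_of_ne h hne.symm)⟩

end Fiedler

/-! ### Thresholds -/

/-- A property of natural numbers that fails eventually has best-possible thresholds: one less than
its first failure, and one less than the start of its final run of failures. -/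
theorem exists_thresholds {D : ℕ → Prop} {N : ℕ} (hN : ∀ p, N ≤ p → ¬ D p) :
    ∃ a b : ℝ, (∀ n : ℕ, (n : ℝ) ≤ a ↔ ∀ p ≤ n, D p) ∧
      (∀ n : ℕ, b < n ↔ ∀ p, n ≤ p → ¬ D p) ∧ b ≤ N := by
  classical
  have h1 : ∃ p, ¬ D p := ⟨N, hN N le_rfl⟩
  have h2 : ∃ n, ∀ p, n ≤ p → ¬ D p := ⟨N, hN⟩
  refine ⟨(Nat.find h1 : ℝ) - 1, (Nat.find h2 : ℝ) - 1, fun n => ?_, fun n => ?_, ?_⟩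
  · rw [le_sub_iff_add_le]
    norm_cast
    rw [Nat.add_one_le_iff, Nat.lt_find_iff]
    simp
  · rw [sub_lt_iff_lt_add]
    norm_cast
    rw [Nat.lt_add_one_iff]
    refine ⟨fun h p hp => Nat.find_spec h2 p (h.trans hp), fun h => Nat.find_min' h2 h⟩
  · have : (Nat.find h2 : ℝ) ≤ N := by exact_mod_cast Nat.find_min' h2 hN
    linarith

theorem tendsto_roseAngle :
    Tendsto (fun s : ℕ => Real.pi / (2 * (s : ℝ) + 1) / 2) atTop (nhds 0) := by
  have : Tendsto (fun s : ℕ => 2 * (s : ℝ) + 1) atTop atTop :=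
    tendsto_atTop_add_const_right _ _ (tendsto_natCast_atTop_atTop.const_mul_atTop two_pos)
  simpa using (this.const_div_atTop Real.pi).div_const 2

/-- With `y = π / (2 (2 s + 1))` one has `roseRadius s = 4 sin² y`, and `sin y / y → 1`. -/
theorem isEquivalent_roseRadius_threshold :
    (fun s : ℕ => (roseRadius s - 1) ^ 2 / roseRadius s) ~[atTop]
      (fun s : ℕ => 4 / Real.pi ^ 2 * (s : ℝ) ^ 2) := by
  have hr : ∀ s : ℕ, roseRadius s = 4 * Real.sin (Real.pi / (2 * (s : ℝ) + 1) / 2) ^ 2 := by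
    intro s
    have h := Real.cos_two_mul (Real.pi / (2 * (s : ℝ) + 1) / 2)
    rw [mul_div_cancel₀ _ two_ne_zero, Real.cos_sq'] at h
    rw [roseRadius, h]; ring
  have hsin : Tendsto (fun s : ℕ => Real.sinc (Real.pi / (2 * (s : ℝ) + 1) / 2)) atTop (nhds 1) := by
    have := (Real.continuous_sinc.tendsto 0).comp tendsto_roseAngle
    rwa [Real.sinc_zero] at this
  have hr0 : Tendsto roseRadius atTop (nhds 0) := by
    have h := (Real.continuous_sin.tendsto 0).comp tendsto_roseAngle
    have h' := (h.pow 2).const_mul 4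
    simp only [Real.sin_zero] at h'
    norm_num at h'
    exact h'.congr fun s => (hr s).symm
  have hfrac : Tendsto (fun s : ℕ => (s : ℝ) / ((s : ℝ) + 1 / 2)) atTop (nhds 1) :=
    tendsto_natCast_div_add_atTop (1 / 2 : ℝ)
  have hlim : Tendsto (fun s : ℕ => (roseRadius s - 1) ^ 2 /
      (((s : ℝ) / ((s : ℝ) + 1 / 2)) ^ 2 * Real.sinc (Real.pi / (2 * (s : ℝ) + 1) / 2) ^ 2))
      atTop (nhds 1) := by
    have := ((hr0.sub_const 1).pow 2).div ((hfrac.pow 2).mul (hsin.pow 2)) (by norm_num)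
    simpa [Pi.div_def] using this
  refine isEquivalent_of_tendsto_one (hlim.congr' ?_)
  filter_upwards [eventually_ge_atTop 1] with s hs
  have hs' : (0 : ℝ) < s := by exact_mod_cast hs
  have hpi := Real.pi_pos
  have hy : Real.pi / (2 * (s : ℝ) + 1) / 2 ≠ 0 := by positivity
  have hpos := roseRadius_pos s
  rw [Pi.div_apply, Real.sinc_of_ne_zero hy]
  have hden : ((s : ℝ) / ((s : ℝ) + 1 / 2)) ^ 2 * (Real.sin (Real.pi / (2 * (s : ℝ) + 1) / 2) /
      (Real.pi / (2 * (s : ℝ) + 1) / 2)) ^ 2 =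
      roseRadius s * (4 / Real.pi ^ 2 * (s : ℝ) ^ 2) := by
    rw [hr s]
    field_simp
    ring
  rw [hden, div_div]

theorem theorem2 :
    -- the Fiedler vector of every Rose tree `R(s,t,p)` with `s, t ≥ 3` is unique
    (∀ s t p : ℕ, 3 ≤ s → 3 ≤ t → HasUniqueFiedlerVector (roseTree s t p)) ∧
    ∃ f_m f_M : ℕ → ℕ → ℝ,
      -- `f_m` is a threshold below which (FED) is true, and it is best possible
      (∀ s t : ℕ, 3 ≤ s → 3 ≤ t → ∀ n : ℕ,
        ((n : ℝ) ≤ f_m s t ↔ ∀ p : ℕ, p ≤ n → FED (roseTree s t p))) ∧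
      -- `f_M` is a threshold above which (FED) is false, and it is best possible
      (∀ s t : ℕ, 3 ≤ s → 3 ≤ t → ∀ n : ℕ,
        (f_M s t < (n : ℝ) ↔ ∀ p : ℕ, n ≤ p → ¬ FED (roseTree s t p))) ∧
      -- the symmetric case
      (∀ s : ℕ, 3 ≤ s →
        f_m s s = (roseRadius s - 1) ^ 2 / roseRadius s ∧
        f_M s s = (roseRadius s - 1) ^ 2 / roseRadius s) ∧
      (fun s : ℕ => f_m s s) ~[atTop] (fun s : ℕ => 4 / Real.pi ^ 2 * (s : ℝ) ^ 2) ∧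
      (fun s : ℕ => f_M s s) ~[atTop] (fun s : ℕ => 4 / Real.pi ^ 2 * (s : ℝ) ^ 2) ∧
      -- for fixed `s`, the supremum of `f_M s t` over `t` is finite, and (FED) fails beyond it
      (∀ s : ℕ, 3 ≤ s →
        BddAbove (f_M s '' Set.Ici 3) ∧
        ∀ p : ℕ, sSup (f_M s '' Set.Ici 3) < (p : ℝ) →
          ∀ t : ℕ, 3 ≤ t → ¬ FED (roseTree s t p)) := by
  -- The last bound does not depend on `t`.
  have key : ∀ s t : ℕ, ∃ a b : ℝ, 3 ≤ s → 3 ≤ t →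
      (∀ n : ℕ, (n : ℝ) ≤ a ↔ ∀ p : ℕ, p ≤ n → FED (roseTree s t p)) ∧
      (∀ n : ℕ, b < (n : ℝ) ↔ ∀ p : ℕ, n ≤ p → ¬ FED (roseTree s t p)) ∧
      (s = t → a = (roseRadius s - 1) ^ 2 / roseRadius s ∧
        b = (roseRadius s - 1) ^ 2 / roseRadius s) ∧
      b ≤ max ((s * (s + 1) : ℕ) : ℝ) ((roseRadius s - 1) ^ 2 / roseRadius s) := by
    intro s t
    by_cases hst : s = t
    · subst hst
      refine ⟨(roseRadius s - 1) ^ 2 / roseRadius s, (roseRadius s - 1) ^ 2 / roseRadius s,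
        fun hs _ => ⟨fun n => ?_, fun n => ?_, fun _ => ⟨rfl, rfl⟩, le_max_right _ _⟩⟩
      · simp only [FED_roseTree_self_iff hs]
        exact ⟨fun h p hp => le_trans (by exact_mod_cast hp) h, fun h => h n le_rfl⟩
      · simp only [FED_roseTree_self_iff hs, not_le]
        exact ⟨fun h p hp => lt_of_lt_of_le h (by exact_mod_cast hp), fun h => h n le_rfl⟩
    · by_cases h : 3 ≤ s ∧ 3 ≤ t
      · obtain ⟨a, b, h1, h2, h3⟩ := exists_thresholds (D := fun p => FED (roseTree s t p))
          (N := s * (s + 1)) fun p hp => roseTree_not_FED_of_le h.1 h.2 (by omega)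
        exact ⟨a, b, fun _ _ => ⟨h1, h2, fun h => absurd h hst, h3.trans (le_max_left _ _)⟩⟩
      · exact ⟨0, 0, fun hs ht => absurd ⟨hs, ht⟩ h⟩
  choose f_m f_M hf using key
  have hdiag : ∀ s : ℕ, 3 ≤ s → f_m s s = (roseRadius s - 1) ^ 2 / roseRadius s ∧
      f_M s s = (roseRadius s - 1) ^ 2 / roseRadius s :=
    fun s hs => (hf s s hs hs).2.2.1 rfl
  refine ⟨fun s t p hs ht => roseTree_hasUniqueFiedlerVector hs ht, f_m, f_M,
    fun s t hs ht => (hf s t hs ht).1, fun s t hs ht => (hf s t hs ht).2.1, hdiag, ?_, ?_,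
    fun s hs => ?_⟩
  · refine isEquivalent_roseRadius_threshold.congr_left ?_
    filter_upwards [eventually_ge_atTop 3] with s hs using (hdiag s hs).1.symm
  · refine isEquivalent_roseRadius_threshold.congr_left ?_
    filter_upwards [eventually_ge_atTop 3] with s hs using (hdiag s hs).2.symm
  · have hbdd : BddAbove (f_M s '' Set.Ici 3) := by
      refine ⟨max ((s * (s + 1) : ℕ) : ℝ) ((roseRadius s - 1) ^ 2 / roseRadius s), ?_⟩
      rintro _ ⟨t, ht, rfl⟩
      exact (hf s t hs ht).2.2.2
    refine ⟨hbdd, fun p hp t ht => ?_⟩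
    exact ((hf s t hs ht).2.1 p).1 ((le_csSup hbdd ⟨t, ht, rfl⟩).trans_lt hp) p le_rfl
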